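/- Let $n\ge 0$ and let $\varphi:\mathbb R^n\to(-\infty,+\infty]$ be convex. Let $D$ be the interior of $\{x:\varphi(x)<\infty\}$ and $T_D=\{z\in\mathbb C^n:\operatorname{Re}z\in D\}$. Let $A^2(e^{-\varphi})$ be the space of holomorphic functions $f$ on $T_D$ with $$\|f\|_{A^2}^2:=\int_{D\times\mathbb R^n}|f(x+iy)|^2e^{-\varphi(x)}\,dx\,dy<\infty .$$ Let $\tilde\varphi:\mathbb R^n\to[-\infty,+\infty]$ be the logarithmic Laplace transform of $\varphi$, defined by $$e^{\tilde\varphi(t)}=\int_{\mathbb R^n}e^{2t\cdot x-\varphi(x)}\,dx ,$$ and let $PW(e^{\tilde\varphi})$ be the space of holomorphic functions on $T_D$ of the form $$f(z)=\int_{\mathbb R^n}e^{t\cdot z}\tilde f(t)\,dt$$ (absolutely convergent for every $z\in T_D$), where $t\cdot z=\sum_j t_jz_j$ and $\tilde f:\mathbb R^n\to\mathbb C$ is measurable with $$\|f\|_{PW}^2:=\int_{\mathbb R^n}|\tilde f(t)|^2e^{\tilde\varphi(t)}\,dt<\infty ,$$ the last condition being understood so that $\tilde f=0$ almost everywhere on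 $\{\tilde\varphi=+\infty\}$. Then every measurable $\tilde f$ with $\int|\tilde f|^2e^{\tilde\varphi}\,dt<\infty$ defines in this way an element of $PW(e^{\tilde\varphi})$, the spaces $PW(e^{\tilde\varphi})$ and $A^2(e^{-\varphi})$ are equal, and $$\|f\|_{A^2}^2=(2\pi)^n\|f\|_{PW}^2$$ for every $f$ in this space and every $\tilde f$ representing it. -/

import Mathlib

open MeasureTheory

noncomputable section

/-- `ℝⁿ` with its Euclidean structure; `volume` on it is Lebesgue measure. -/
abbrev RSpace (n : ℕ) : Type := EuclideanSpace ℝ (Fin n)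

/-- `ℂⁿ`. -/
abbrev CSpace (n : ℕ) : Type := EuclideanSpace ℂ (Fin n)

/-- The point `x + i y` of `ℂⁿ`. -/
def toComplex {n : ℕ} (x y : RSpace n) : CSpace n :=
  WithLp.toLp 2 fun j => (x j : ℂ) + (y j : ℂ) * Complex.I

/-- The real part `Re z ∈ ℝⁿ` of `z ∈ ℂⁿ`. -/
def rePart {n : ℕ} (z : CSpace n) : RSpace n :=
  WithLp.toLp 2 fun j => (z j).re

/-- The tube domain `{z : Re z ∈ D}` over `D ⊆ ℝⁿ`. -/
def tube {n : ℕ} (D : Set (RSpace n)) : Set (CSpace n) :=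
  {z | rePart z ∈ D}

/-- The bilinear pairing `t · z = ∑ tⱼ zⱼ` of `t ∈ ℝⁿ` and `z ∈ ℂⁿ`. -/
def pairing {n : ℕ} (t : RSpace n) (z : CSpace n) : ℂ :=
  ∑ j, (t j : ℂ) * z j

/-- A convex function on `ℝⁿ` with values in `(-∞, +∞]`: it never takes the value `-∞`,
and its epigraph is convex. -/
def IsConvexFunction {n : ℕ} (φ : RSpace n → EReal) : Prop :=
  (∀ x, φ x ≠ ⊥) ∧ Convex ℝ {p : RSpace n × ℝ | φ p.1 ≤ (p.2 : EReal)}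

/-- The interior of the set where `φ` is finite (for `φ > -∞`). -/
def finiteDomain {n : ℕ} (φ : RSpace n → EReal) : Set (RSpace n) :=
  interior {x | φ x < ⊤}

/-- `‖f‖²` in the Bergman space: the integral of `|f(x + iy)|² e^{-φ(x)}` with respect to `dx dy`
over the tube over the interior of `{φ < ∞}`. -/
def bergmanNormSq {n : ℕ} (φ : RSpace n → EReal) (f : CSpace n → ℂ) : ENNReal :=
  ∫⁻ p : RSpace n × RSpace n in finiteDomain φ ×ˢ Set.univ,
    ‖f (toComplex p.1 p.2)‖ₑ ^ 2 * EReal.exp (-φ p.1)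

/-- The Bergman space `A²(e^{-φ(Re z)})`: functions that are holomorphic in the tube over the
interior of `{φ < ∞}` and square integrable there against `e^{-φ(Re z)}`.
A function on the tube is represented by any function on `ℂⁿ` that restricts to it. -/
def bergmanSpace {n : ℕ} (φ : RSpace n → EReal) : Set (CSpace n → ℂ) :=
  {f | DifferentiableOn ℂ f (tube (finiteDomain φ)) ∧ bergmanNormSq φ f < ⊤}

/-- The logarithmic Laplace transform `φ̃`, `e^{φ̃(t)} = ∫ e^{2 t · x - φ(x)} dx`, with values in
`[-∞, +∞]`. -/
def logLaplace {n : ℕ} (φ : RSpace n → EReal) (t : RSpace n) : EReal :=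
  ENNReal.log (∫⁻ x : RSpace n, EReal.exp (((2 * inner ℝ t x : ℝ) : EReal) - φ x))

/-- The integral of `|g(t)|² e^{ψ(t)}`. Where `ψ = +∞` the integrand is `+∞` unless `g` vanishes,
so finiteness forces `g = 0` almost everywhere on `{ψ = +∞}`. -/
def pwNormSq {n : ℕ} (ψ : RSpace n → EReal) (g : RSpace n → ℂ) : ENNReal :=
  ∫⁻ t : RSpace n, ‖g t‖ₑ ^ 2 * EReal.exp (ψ t)

/-- The Fourier–Laplace transform `z ↦ ∫ e^{t · z} g(t) dt`. -/
def fourierLaplace {n : ℕ} (g : RSpace n → ℂ) (z : CSpace n) : ℂ :=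
  ∫ t : RSpace n, Complex.exp (pairing t z) * g t

/-- On the tube over `D`, `f` is a holomorphic function given by the absolutely convergent
integral `f(z) = ∫ e^{t · z} g(t) dt`, where `g` is (Lebesgue) measurable and
`∫ |g|² e^ψ dt < ∞`. -/
structure IsPWRepresentation {n : ℕ} (D : Set (RSpace n)) (ψ : RSpace n → EReal)
    (g : RSpace n → ℂ) (f : CSpace n → ℂ) : Prop where
  aestronglyMeasurable : AEStronglyMeasurable g volume
  normSq_lt_top : pwNormSq ψ g < ⊤
  integrable : ∀ z ∈ tube D, Integrable (fun t => Complex.exp (pairing t z) * g t) volume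
  eq_fourierLaplace : ∀ z ∈ tube D, f z = fourierLaplace g z
  holomorphic : DifferentiableOn ℂ f (tube D)

/-- The generalized Paley–Wiener space `PW(e^ψ)`, as a space of functions on the tube over `D`
(each represented by any function on `ℂⁿ` that restricts to it). -/
def paleyWienerSpace {n : ℕ} (D : Set (RSpace n)) (ψ : RSpace n → EReal) : Set (CSpace n → ℂ) :=
  {f | ∃ g, IsPWRepresentation D ψ g f}

end

open Set Filter Topology

noncomputable section

/-! Write `W = e^{-φ}`. For fixed `x ∈ D` the slice `y ↦ f(x + iy)` is, up to the scaling `y = 2πw`,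
the inverse Fourier transform of `e^{t·x} g(t)`. Plancherel turns its squared norm into `(2π)ⁿ ∫
e^{2t·x} |g(t)|² dt`. Multiplying by `W(x)`, integrating over `D` and applying Tonelli gives `(2π)ⁿ
∫ |g|² e^{φ̃}`, which is the norm identity. Convexity of `φ` is used only to make `W` an
`IsTubeWeight` (null off `D`, locally bounded below on `D`) and to make `D` convex.

From `g` to `f`: near `x ∈ D` the weight is bounded below on a ball, so `e^{φ̃(t)}` dominates a
multiple of `e^{2(t·x + δ‖t‖)}` (`IsTubeWeight.exists_le_laplaceWeight`). The spare factor
`e^{δ‖t‖}` gives absolute convergence by Cauchy–Schwarz and holomorphy by differentiation under the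
integral.

From `f` to `g`: almost every slice is in `L²`, so `g(t) = e^{-t·x}` times the `L²` Fourier
transform of the slice over `x` is available, and it must be shown not to depend on `x`. This is
Cauchy's theorem (`HasVerticalDecay.integral_slice_eq`), which needs vertical decay. The sub-mean
value inequality bounds `f` locally uniformly in `x` (`IsTubeWeight.exists_norm_le`), so `f(z) e^{ε
z·z}` decays. Letting `ε → 0` in `L²` gives the independence for `f`
(`ae_exp_neg_mul_fourier_toLp_scaledSlice_eq`). Fourier inversion recovers `f` on almost every
slice, and continuity recovers it everywhere. -/

lemma ContinuousOn.measurable_indicator {α β : Type*} [TopologicalSpace α] [MeasurableSpace α]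
    [OpensMeasurableSpace α] [TopologicalSpace β] [MeasurableSpace β] [BorelSpace β] [Zero β]
    {f : α → β} {s : Set α} (hf : ContinuousOn f s) (hs : MeasurableSet s) :
    Measurable (s.indicator f) := by
  classical
  rw [← Set.piecewise_eq_indicator]
  exact hf.measurable_piecewise continuousOn_const hs

/-- A weight on `ℝⁿ` that lives on the open set `D` and is locally bounded below there. -/
structure IsTubeWeight {n : ℕ} (D : Set (RSpace n)) (W : RSpace n → ENNReal) : Prop where
  isOpen : IsOpen D
  aemeasurable : AEMeasurable W volume
  ae_eq_zero : ∀ᵐ x ∂volume, x ∉ D → W x = 0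
  exists_le : ∀ x ∈ D, ∃ r > 0, ∃ c > 0, Metric.ball x r ⊆ D ∧
    ∀ u ∈ Metric.ball x r, ENNReal.ofReal c ≤ W u

/-- The Laplace transform `t ↦ ∫ e^{2 t · x} W(x) dx`. -/
def laplaceWeight {n : ℕ} (W : RSpace n → ENNReal) (t : RSpace n) : ENNReal :=
  ∫⁻ x, ENNReal.ofReal (Real.exp (2 * inner ℝ t x)) * W x

/-! ### Convex functions and the weight `e^{-φ}` -/

section ConvexWeight

variable {n : ℕ} {φ : RSpace n → EReal}

lemma IsConvexFunction.convexOn_toReal (hφ : IsConvexFunction φ) :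
    ConvexOn ℝ {x | φ x < ⊤} fun x => (φ x).toReal := by
  have key : ∀ x ∈ {x | φ x < ⊤}, φ x = ((φ x).toReal : EReal) := fun x hx =>
    (EReal.coe_toReal (ne_of_lt hx) (hφ.1 x)).symm
  have comb : ∀ x ∈ {x | φ x < ⊤}, ∀ y ∈ {x | φ x < ⊤}, ∀ a b : ℝ, 0 ≤ a → 0 ≤ b → a + b = 1 →
      φ (a • x + b • y) ≤ ((a * (φ x).toReal + b * (φ y).toReal : ℝ) : EReal) := by
    intro x hx y hy a b ha hb hab
    have h := hφ.2 (x := (x, (φ x).toReal)) (key x hx).le (y := (y, (φ y).toReal))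
      (key y hy).le ha hb hab
    simpa using h
  refine ⟨fun x hx y hy a b ha hb hab => ?_, fun x hx y hy a b ha hb hab => ?_⟩
  · exact (comb x hx y hy a b ha hb hab).trans_lt (EReal.coe_lt_top _)
  · have h := comb x hx y hy a b ha hb hab
    have := EReal.toReal_le_toReal h (hφ.1 _) (EReal.coe_ne_top _)
    rwa [EReal.toReal_coe] at this

lemma IsConvexFunction.convex_finiteDomain (hφ : IsConvexFunction φ) :
    Convex ℝ (finiteDomain φ) :=
  hφ.convexOn_toReal.1.interior

lemma IsConvexFunction.continuousOn_exp_neg (hφ : IsConvexFunction φ) :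
    ContinuousOn (fun x => EReal.exp (-φ x)) (finiteDomain φ) := by
  have h := hφ.convexOn_toReal.continuousOn_interior
  have h2 : ContinuousOn (fun x => EReal.exp (-((φ x).toReal : EReal))) (finiteDomain φ) := by
    have : Continuous fun a : ℝ => EReal.exp (-(a : EReal)) :=
      ENNReal.continuous_exp.comp (continuous_neg.comp continuous_coe_real_ereal)
    exact this.comp_continuousOn h
  refine h2.congr fun x hx => ?_
  have hx' : φ x < ⊤ := interior_subset (s := {x | φ x < ⊤}) hx
  simp only [EReal.coe_toReal hx'.ne (hφ.1 x)]

/-- The frontier of a convex set is Lebesgue null, so `φ = +∞` almost everywhere off the interior. A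
finite convex function is continuous on the interior of its domain, which gives measurability and
the local lower bound. -/
lemma IsConvexFunction.isTubeWeight (hφ : IsConvexFunction φ) :
    IsTubeWeight (finiteDomain φ) fun x => EReal.exp (-φ x) := by
  have hopen : IsOpen (finiteDomain φ) := isOpen_interior
  have hzero : ∀ᵐ x ∂(volume : Measure (RSpace n)), x ∉ finiteDomain φ → EReal.exp (-φ x) = 0 := by
    have hfr := hφ.convexOn_toReal.1.addHaar_frontier (μ := volume)
    filter_upwards [measure_eq_zero_iff_ae_notMem.1 hfr] with x hx hxD
    have hx' : ¬ φ x < ⊤ := fun h => hx ⟨subset_closure h, hxD⟩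
    simp [not_lt_top_iff.1 hx']
  refine ⟨hopen, ?_, hzero, fun x hx => ?_⟩
  · refine ⟨(finiteDomain φ).indicator fun x => EReal.exp (-φ x), ?_, ?_⟩
    · exact hφ.continuousOn_exp_neg.measurable_indicator hopen.measurableSet
    · filter_upwards [hzero] with x hx
      by_cases h : x ∈ finiteDomain φ
      · simp [h]
      · simp [h, hx h]
  · have hx' : φ x < ⊤ := interior_subset (s := {x | φ x < ⊤}) hx
    have hpos : 0 < EReal.exp (-φ x) := by
      rw [EReal.zero_lt_exp_iff, bot_lt_iff_ne_bot]
      simpa using hx'.ne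
    obtain ⟨c, -, hc0, hc⟩ := ENNReal.lt_iff_exists_real_btwn.1 hpos
    have hc0' : 0 < c := by simpa using hc0
    have hcont := hφ.continuousOn_exp_neg.continuousAt (hopen.mem_nhds hx)
    have hev := (hcont.eventually (lt_mem_nhds hc)).and (hopen.mem_nhds hx)
    obtain ⟨r, hr, hb⟩ := Metric.eventually_nhds_iff_ball.1 hev
    exact ⟨r, hr, c, hc0', fun u hu => (hb u hu).2, fun u hu => (hb u hu).1.le⟩

lemma exp_logLaplace (φ : RSpace n → EReal) (t : RSpace n) :
    EReal.exp (logLaplace φ t) = laplaceWeight (fun x => EReal.exp (-φ x)) t := by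
  simp only [logLaplace, laplaceWeight, ENNReal.exp_log, sub_eq_add_neg, EReal.exp_add,
    EReal.exp_coe]

end ConvexWeight

/-! ### Exponential lower bound for the Laplace transform -/

section LowerBound

variable {n : ℕ} {D : Set (RSpace n)} {W : RSpace n → ENNReal}

/-- Over a point of the domain, the Laplace transform of a weight grows strictly faster than
`e^{2 t · x}`. -/
lemma IsTubeWeight.exists_le_laplaceWeight (hW : IsTubeWeight D W) {x : RSpace n} (hx : x ∈ D) :
    ∃ c > 0, ∃ δ > 0, ∀ t, ENNReal.ofReal (c * Real.exp (2 * (inner ℝ t x + δ * ‖t‖))) ≤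
      laplaceWeight W t := by
  obtain ⟨r, hr, c, hc, -, hle⟩ := hW.exists_le x hx
  set v := (volume (Metric.ball (0 : RSpace n) (r / 4))) with hv
  have hv0 : v ≠ 0 := (Metric.measure_ball_pos volume _ (by positivity)).ne'
  have hvt : v ≠ ⊤ := measure_ball_lt_top.ne
  refine ⟨c * v.toReal, mul_pos hc (ENNReal.toReal_pos hv0 hvt), r / 4, by positivity,
    fun t => ?_⟩
  -- The direction of `t`; it is `0` when `t = 0`, which is harmless.
  set e : RSpace n := (‖t‖⁻¹) • t with he
  have he1 : ‖e‖ ≤ 1 := by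
    rw [he, norm_smul, norm_inv, norm_norm]
    exact inv_mul_le_one
  have hte : inner ℝ t e = ‖t‖ := by
    rw [he, inner_smul_right, real_inner_self_eq_norm_sq]
    rcases eq_or_ne ‖t‖ 0 with h | h
    · simp [h]
    · field_simp
  -- Shifting the centre by `r/2` towards `t` gains `r/2 * ‖t‖` in the inner product. The radius
  -- `r/4` loses at most half of this gain and keeps the ball inside `ball x r`.
  set p := x + (r / 2) • e with hp
  have hsub : ∀ u ∈ Metric.ball p (r / 4), ENNReal.ofReal c ≤ W u ∧
      inner ℝ t x + r / 4 * ‖t‖ ≤ inner ℝ t u := by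
    intro u hu
    have hu' : ‖u - p‖ < r / 4 := by simpa [dist_eq_norm] using hu
    have hpx : ‖p - x‖ ≤ r / 2 := by
      rw [hp, add_sub_cancel_left, norm_smul, Real.norm_of_nonneg (by positivity)]
      nlinarith
    constructor
    · refine hle u ?_
      rw [Metric.mem_ball, dist_eq_norm]
      calc ‖u - x‖ = ‖(u - p) + (p - x)‖ := by congr 1; abel
        _ ≤ ‖u - p‖ + ‖p - x‖ := norm_add_le _ _
        _ < r := by linarith
    · have h1 : inner ℝ t u = inner ℝ t x + r / 2 * ‖t‖ + inner ℝ t (u - p) := by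
        rw [hp, inner_sub_right, inner_add_right, inner_smul_right, hte]; ring
      have h2 : -(‖t‖ * ‖u - p‖) ≤ inner ℝ t (u - p) :=
        neg_le_of_abs_le (abs_real_inner_le_norm _ _)
      have h3 : ‖t‖ * ‖u - p‖ ≤ ‖t‖ * (r / 4) :=
        mul_le_mul_of_nonneg_left hu'.le (norm_nonneg _)
      linarith
  calc ENNReal.ofReal (c * v.toReal * Real.exp (2 * (inner ℝ t x + r / 4 * ‖t‖)))
      = ∫⁻ _ in Metric.ball p (r / 4),
          ENNReal.ofReal (Real.exp (2 * (inner ℝ t x + r / 4 * ‖t‖))) * ENNReal.ofReal c := by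
        rw [lintegral_const, Measure.restrict_apply_univ, Measure.addHaar_ball_center,
          ← hv, ENNReal.ofReal_mul (by positivity), ENNReal.ofReal_mul hc.le,
          ENNReal.ofReal_toReal hvt]
        ring
    _ ≤ ∫⁻ u in Metric.ball p (r / 4), ENNReal.ofReal (Real.exp (2 * inner ℝ t u)) * W u := by
        refine setLIntegral_mono' measurableSet_ball fun u hu => ?_
        obtain ⟨h1, h2⟩ := hsub u hu
        gcongr
    _ ≤ laplaceWeight W t := setLIntegral_le_lintegral _ _

end LowerBound

/-! ### Fourier transform on `L¹ ∩ L²` and Plancherel's theorem -/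

section Plancherel

open FourierTransform SchwartzMap ENNReal

variable {V : Type*} [NormedAddCommGroup V] [InnerProductSpace ℝ V] [FiniteDimensional ℝ V]
  [MeasurableSpace V] [BorelSpace V]

lemma Real.continuous_fourier {f : V → ℂ} (hf : Integrable f) : Continuous (𝓕 f) :=
  VectorFourier.fourierIntegral_continuous Real.continuous_fourierChar
    (by exact continuous_inner) hf

lemma Real.fourierInv_eq_fourier_comp (f : V → ℂ) : 𝓕⁻ f = fun w => 𝓕 f (-w) :=
  funext fun w => Real.fourierInv_eq_fourier_neg f w

lemma Real.continuous_fourierInv {f : V → ℂ} (hf : Integrable f) : Continuous (𝓕⁻ f) := by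
  rw [Real.fourierInv_eq_fourier_comp]
  exact (Real.continuous_fourier hf).comp continuous_neg

lemma integral_fourier_mul_eq {f g : V → ℂ} (hf : Integrable f) (hg : Integrable g) :
    ∫ x, 𝓕 f x * g x = ∫ x, f x * 𝓕 g x := by
  have := VectorFourier.integral_fourierIntegral_smul_eq_flip (μ := volume) (ν := volume)
    (L := innerₗ V) Real.continuous_fourierChar (by exact continuous_inner) hf hg
  rw [flip_innerₗ] at this
  exact this

lemma integral_fourierInv_mul_eq {f g : V → ℂ} (hf : Integrable f) (hg : Integrable g) :
    ∫ x, 𝓕⁻ f x * g x = ∫ x, f x * 𝓕⁻ g x := by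
  have h := integral_fourier_mul_eq hf (hg.comp_neg)
  have hF : 𝓕 (fun x => g (-x)) = 𝓕⁻ g := by
    rw [Real.fourierInv_eq_fourier_comp_neg]
  rw [hF] at h
  rw [← h, Real.fourierInv_eq_fourier_comp,
    ← integral_neg_eq_self (fun x => 𝓕 f x * g (-x))]
  simp

lemma ae_eq_of_forall_schwartz_integral_mul_eq {f g : V → ℂ} (hf : LocallyIntegrable f)
    (hg : LocallyIntegrable g) (h : ∀ ψ : 𝓢(V, ℂ), ∫ x, ψ x * f x = ∫ x, ψ x * g x) :
    f =ᵐ[volume] g := by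
  refine ae_eq_of_integral_contDiff_smul_eq hf hg fun ψ hψ hψc => ?_
  have hs : HasCompactSupport fun x => (ψ x : ℂ) := hψc.comp_left (g := Complex.ofReal) rfl
  have := h (hs.toSchwartzMap (Complex.ofRealCLM.contDiff.comp hψ))
  simp only [Complex.real_smul]
  exact this

/-- On `L¹ ∩ L²` the `L²` Fourier transform is given by the Fourier integral. -/
lemma coeFn_fourier_toLp {f : V → ℂ} (hf : Integrable f) (hf2 : MemLp f 2) :
    ((𝓕 (hf2.toLp f) : Lp ℂ 2 (volume : Measure V)) : V → ℂ) =ᵐ[volume] 𝓕 f := by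
  refine ae_eq_of_forall_schwartz_integral_mul_eq
    ((Lp.memLp _).locallyIntegrable (by norm_num)) (Real.continuous_fourier hf).locallyIntegrable
    fun ψ => ?_
  -- The `L²` transform agrees with that of tempered distributions, so pairing with a Schwartz
  -- function moves the transform onto that function.
  have h := DFunLike.congr_fun (Lp.fourier_toTemperedDistribution_eq (hf2.toLp f)) ψ
  rw [TemperedDistribution.fourier_apply, Lp.toTemperedDistribution_apply,
    Lp.toTemperedDistribution_apply] at h
  simp only [smul_eq_mul] at h
  rw [← h, ← integral_fourier_mul_eq ψ.integrable hf]
  refine integral_congr_ae ?_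
  filter_upwards [hf2.coeFn_toLp] with x hx
  rw [hx, SchwartzMap.fourier_coe]

lemma coeFn_fourierInv_toLp {f : V → ℂ} (hf : Integrable f) (hf2 : MemLp f 2) :
    ((𝓕⁻ (hf2.toLp f) : Lp ℂ 2 (volume : Measure V)) : V → ℂ) =ᵐ[volume] 𝓕⁻ f := by
  refine ae_eq_of_forall_schwartz_integral_mul_eq
    ((Lp.memLp _).locallyIntegrable (by norm_num))
    (Real.continuous_fourierInv hf).locallyIntegrable fun ψ => ?_
  have h := DFunLike.congr_fun (Lp.fourierInv_toTemperedDistribution_eq (hf2.toLp f)) ψ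
  rw [TemperedDistribution.fourierInv_apply, Lp.toTemperedDistribution_apply,
    Lp.toTemperedDistribution_apply] at h
  simp only [smul_eq_mul] at h
  rw [← h, ← integral_fourierInv_mul_eq ψ.integrable hf]
  refine integral_congr_ae ?_
  filter_upwards [hf2.coeFn_toLp] with x hx
  rw [hx, SchwartzMap.fourierInv_coe]

lemma lintegral_enorm_sq_eq_eLpNorm {α : Type*} [MeasurableSpace α] (μ : Measure α) (f : α → ℂ) :
    ∫⁻ x, ‖f x‖ₑ ^ 2 ∂μ = eLpNorm f 2 μ ^ 2 := by
  rw [eLpNorm_eq_lintegral_rpow_enorm_toReal (by norm_num) (by norm_num), ← ENNReal.rpow_natCast,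
    ← ENNReal.rpow_mul]
  simp

lemma memLp_two_iff_lintegral {α : Type*} [MeasurableSpace α] {μ : Measure α} {f : α → ℂ}
    (hf : AEStronglyMeasurable f μ) : MemLp f 2 μ ↔ ∫⁻ x, ‖f x‖ₑ ^ 2 ∂μ < ⊤ := by
  rw [lintegral_enorm_sq_eq_eLpNorm, ENNReal.pow_lt_top_iff]
  simp [MemLp, hf]

lemma lintegral_enorm_sq_fourier_toLp {f : V → ℂ} (hf2 : MemLp f 2) :
    ∫⁻ x, ‖(𝓕 (hf2.toLp f) : Lp ℂ 2 (volume : Measure V)) x‖ₑ ^ 2 = ∫⁻ x, ‖f x‖ₑ ^ 2 := by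
  rw [lintegral_enorm_sq_eq_eLpNorm, lintegral_enorm_sq_eq_eLpNorm, ← Lp.enorm_def,
    ← eLpNorm_congr_ae hf2.coeFn_toLp, ← Lp.enorm_def, enorm_eq_nnnorm, enorm_eq_nnnorm]
  have : ‖(𝓕 (hf2.toLp f) : Lp ℂ 2 (volume : Measure V))‖₊ = ‖hf2.toLp f‖₊ :=
    NNReal.eq (Lp.norm_fourier_eq _)
  rw [this]

/-- Plancherel's theorem on `L¹ ∩ L²`. -/
lemma lintegral_enorm_sq_fourier {f : V → ℂ} (hf : Integrable f) (hf2 : MemLp f 2) :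
    ∫⁻ x, ‖𝓕 f x‖ₑ ^ 2 = ∫⁻ x, ‖f x‖ₑ ^ 2 := by
  rw [← lintegral_enorm_sq_fourier_toLp hf2]
  refine lintegral_congr_ae ?_
  filter_upwards [coeFn_fourier_toLp hf hf2] with x hx
  rw [hx]

lemma lintegral_enorm_sq_fourierInv {f : V → ℂ} (hf : Integrable f) (hf2 : MemLp f 2) :
    ∫⁻ x, ‖𝓕⁻ f x‖ₑ ^ 2 = ∫⁻ x, ‖f x‖ₑ ^ 2 := by
  rw [Real.fourierInv_eq_fourier_comp, ← lintegral_enorm_sq_fourier hf hf2]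
  exact lintegral_neg_eq_self (fun x => ‖𝓕 f x‖ₑ ^ 2)

/-- Used with `c = 2π` to pass to the Fourier kernel `e^{2πi⟨·,·⟩}`; the factor `(2π)ⁿ` of the
theorem arises here. -/
lemma lintegral_eq_ofReal_pow_mul_lintegral_comp_smul {c : ℝ} (hc : 0 < c) {F : V → ENNReal}
    (hF : AEMeasurable F) :
    ∫⁻ y, F y = ENNReal.ofReal (c ^ Module.finrank ℝ V) * ∫⁻ w, F (c • w) := by
  have hmap := Measure.map_addHaar_smul (volume : Measure V) hc.ne'
  have hF' : AEMeasurable F (Measure.map (fun x => c • x) (volume : Measure V)) := by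
    rw [hmap]; exact hF.smul_measure _
  rw [← lintegral_map' hF' (by fun_prop), hmap, lintegral_smul_measure, smul_eq_mul, ← mul_assoc,
    ← ENNReal.ofReal_mul (by positivity), abs_of_pos (by positivity),
    mul_inv_cancel₀ (by positivity)]
  simp

end Plancherel

/-! ### Coordinates on the tube and the pairing `t · z` -/

section TubeGeometry

variable {n : ℕ}

/-- The imaginary part `Im z ∈ ℝⁿ` of `z ∈ ℂⁿ`. -/
def imPart (z : CSpace n) : RSpace n :=
  WithLp.toLp 2 fun j => (z j).im

@[simp] lemma toComplex_apply (x y : RSpace n) (j : Fin n) :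
    toComplex x y j = (x j : ℂ) + (y j : ℂ) * Complex.I := rfl

@[simp] lemma rePart_apply (z : CSpace n) (j : Fin n) : rePart z j = (z j).re := rfl

@[simp] lemma imPart_apply (z : CSpace n) (j : Fin n) : imPart z j = (z j).im := rfl

@[simp] lemma rePart_toComplex (x y : RSpace n) : rePart (toComplex x y) = x := by
  ext j; simp

@[simp] lemma imPart_toComplex (x y : RSpace n) : imPart (toComplex x y) = y := by
  ext j; simp

@[simp] lemma toComplex_rePart_imPart (z : CSpace n) : toComplex (rePart z) (imPart z) = z := by
  ext j; simp

lemma toComplex_add (x y x' y' : RSpace n) :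
    toComplex (x + x') (y + y') = toComplex x y + toComplex x' y' := by
  ext j; simp; ring

lemma toComplex_mem_tube {D : Set (RSpace n)} {x y : RSpace n} :
    toComplex x y ∈ tube D ↔ x ∈ D := by
  simp [tube]

lemma continuous_toComplex : Continuous fun p : RSpace n × RSpace n => toComplex p.1 p.2 := by
  unfold toComplex
  fun_prop

lemma Continuous.toComplex {α : Type*} [TopologicalSpace α] {f g : α → RSpace n}
    (hf : Continuous f) (hg : Continuous g) : Continuous fun a => toComplex (f a) (g a) :=
  continuous_toComplex.comp (hf.prodMk hg)

lemma continuous_rePart : Continuous (rePart : CSpace n → RSpace n) := by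
  unfold rePart
  fun_prop

lemma isOpen_tube {D : Set (RSpace n)} (hD : IsOpen D) : IsOpen (tube D) :=
  hD.preimage continuous_rePart

lemma norm_rePart_le (z : CSpace n) : ‖rePart z‖ ≤ ‖z‖ := by
  rw [EuclideanSpace.norm_eq, EuclideanSpace.norm_eq]
  refine Real.sqrt_le_sqrt (Finset.sum_le_sum fun j _ => ?_)
  exact pow_le_pow_left₀ (norm_nonneg _) (Complex.abs_re_le_norm _) 2

lemma norm_imPart_le (z : CSpace n) : ‖imPart z‖ ≤ ‖z‖ := by
  rw [EuclideanSpace.norm_eq, EuclideanSpace.norm_eq]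
  refine Real.sqrt_le_sqrt (Finset.sum_le_sum fun j _ => ?_)
  exact pow_le_pow_left₀ (norm_nonneg _) (Complex.abs_im_le_norm _) 2

lemma rePart_sub (z w : CSpace n) : rePart (z - w) = rePart z - rePart w := by
  ext j; simp

lemma norm_toComplex_zero (t : RSpace n) : ‖toComplex t 0‖ = ‖t‖ := by
  simp [EuclideanSpace.norm_eq]

lemma inner_eq_sum (t x : RSpace n) : inner ℝ t x = ∑ j, t j * x j := by
  simp [PiLp.inner_apply, mul_comm]

lemma pairing_eq_inner (t : RSpace n) (z : CSpace n) :
    pairing t z = inner ℂ (toComplex t 0) z := by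
  simp [pairing, PiLp.inner_apply, mul_comm]

lemma pairing_toComplex (t x y : RSpace n) :
    pairing t (toComplex x y) = (inner ℝ t x : ℝ) + (inner ℝ t y : ℝ) * Complex.I := by
  simp only [pairing, inner_eq_sum, toComplex_apply]
  push_cast
  rw [Finset.sum_mul, ← Finset.sum_add_distrib]
  exact Finset.sum_congr rfl fun j _ => by ring

lemma re_pairing (t : RSpace n) (z : CSpace n) : (pairing t z).re = inner ℝ t (rePart z) := by
  rw [← toComplex_rePart_imPart z, pairing_toComplex]
  simp

lemma norm_exp_pairing (t : RSpace n) (z : CSpace n) :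
    ‖Complex.exp (pairing t z)‖ = Real.exp (inner ℝ t (rePart z)) := by
  rw [Complex.norm_exp, re_pairing]

lemma continuous_toComplex_zero : Continuous fun t : RSpace n => toComplex t 0 :=
  continuous_id.toComplex continuous_const

lemma continuous_pairing_left (z : CSpace n) : Continuous fun t => pairing t z := by
  simp only [pairing_eq_inner]
  exact continuous_toComplex_zero.inner continuous_const

lemma hasFDerivAt_exp_pairing (t : RSpace n) (z : CSpace n) :
    HasFDerivAt (fun z => Complex.exp (pairing t z))
      (Complex.exp (pairing t z) • innerSL ℂ (toComplex t 0)) z := by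
  have h : HasFDerivAt (fun z => pairing t z) (innerSL ℂ (toComplex t 0)) z := by
    have := (innerSL ℂ (toComplex t 0)).hasFDerivAt (x := z)
    refine this.congr_of_eventuallyEq (Eventually.of_forall fun w => ?_)
    simp [pairing_eq_inner]
  exact h.cexp

end TubeGeometry

/-! ### Integrability of `e^{-a‖t‖}` -/

section ExpDecay

variable {E : Type*} [NormedAddCommGroup E] [NormedSpace ℝ E] [FiniteDimensional ℝ E]
  [MeasurableSpace E] [BorelSpace E] (μ : Measure E) [μ.IsAddHaarMeasure]

/-- Comparison with `(1 + ‖t‖)^{-k}` for `k = dim E + 1`, using the single term `s^k / k! ≤ e^s` of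
the exponential series at `s = a(1 + ‖t‖)`. -/
lemma integrable_exp_neg_mul_norm {a : ℝ} (ha : 0 < a) :
    Integrable (fun t : E => Real.exp (-(a * ‖t‖))) μ := by
  set k := Module.finrank ℝ E + 1 with hk
  have h := (integrable_one_add_norm (E := E) (μ := μ) (r := (k : ℝ))
    (by rw [hk]; push_cast; linarith)).const_mul (Real.exp a * k.factorial / a ^ k)
  refine h.mono' (by fun_prop) (Eventually.of_forall fun t => ?_)
  have h1 : 0 < 1 + ‖t‖ := by positivity
  have h2 := Real.pow_div_factorial_le_exp (a * (1 + ‖t‖)) (by positivity) k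
  rw [Real.norm_of_nonneg (Real.exp_pos _).le, Real.rpow_neg h1.le, Real.rpow_natCast]
  rw [div_le_iff₀ (by positivity), mul_pow, mul_add, mul_one, Real.exp_add] at h2
  rw [Real.exp_neg, ← div_eq_mul_inv, div_div, inv_eq_one_div,
    div_le_div_iff₀ (by positivity) (by positivity)]
  linarith

end ExpDecay

/-! ### From a density to a holomorphic function: convergence, holomorphy, norm identity -/

section FourierLaplace

open FourierTransform

variable {n : ℕ} {D : Set (RSpace n)} {W : RSpace n → ENNReal} {g : RSpace n → ℂ}

lemma enorm_ofReal_exp_mul_sq (a : ℝ) (w : ℂ) :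
    ‖(Real.exp a : ℂ) * w‖ₑ ^ 2 = ENNReal.ofReal (Real.exp (2 * a)) * ‖w‖ₑ ^ 2 := by
  rw [enorm_mul, mul_pow, ← ofReal_norm, Complex.norm_real,
    Real.norm_of_nonneg (Real.exp_pos _).le, ← ENNReal.ofReal_pow (Real.exp_pos _).le,
    ← Real.exp_nat_mul]
  norm_num

lemma aestronglyMeasurable_exp_mul (hg : AEStronglyMeasurable g volume) {a : RSpace n → ℝ}
    (ha : Continuous a) :
    AEStronglyMeasurable (fun t => (Real.exp (a t) : ℂ) * g t) volume :=
  (Complex.continuous_ofReal.comp (Real.continuous_exp.comp ha)).aestronglyMeasurable.mul hg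

lemma IsTubeWeight.exists_memLp_exp_mul (hW : IsTubeWeight D W)
    (hg : AEStronglyMeasurable g volume) (hfin : ∫⁻ t, ‖g t‖ₑ ^ 2 * laplaceWeight W t < ⊤)
    {x : RSpace n} (hx : x ∈ D) :
    ∃ δ > 0, MemLp (fun t => (Real.exp (inner ℝ t x + δ * ‖t‖) : ℂ) * g t) 2 := by
  obtain ⟨c, hc, δ, hδ, h⟩ := hW.exists_le_laplaceWeight hx
  refine ⟨δ, hδ, ?_⟩
  rw [memLp_two_iff_lintegral (aestronglyMeasurable_exp_mul hg (by fun_prop))]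
  have hle : ENNReal.ofReal c *
      ∫⁻ t, ‖(Real.exp (inner ℝ t x + δ * ‖t‖) : ℂ) * g t‖ₑ ^ 2 < ⊤ := by
    rw [← lintegral_const_mul' _ _ ENNReal.ofReal_ne_top]
    refine lt_of_le_of_lt (lintegral_mono fun t => ?_) hfin
    rw [enorm_ofReal_exp_mul_sq, ← mul_assoc, ← ENNReal.ofReal_mul hc.le, mul_comm]
    gcongr
    exact h t
  refine (ENNReal.mul_lt_top_iff.1 hle).elim And.right fun h => h.elim (fun h => ?_) fun h => ?_
  · exact absurd h (by simpa using hc)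
  · rw [h]
    exact ENNReal.zero_lt_top

/-- Cauchy–Schwarz: half of the exponential margin `δ` is spent on the square integrable factor
`e^{-δ‖t‖/2}`, and the other half survives. -/
lemma IsTubeWeight.exists_integrable_exp_mul (hW : IsTubeWeight D W)
    (hg : AEStronglyMeasurable g volume) (hfin : ∫⁻ t, ‖g t‖ₑ ^ 2 * laplaceWeight W t < ⊤)
    {x : RSpace n} (hx : x ∈ D) :
    ∃ δ > 0, Integrable (fun t => Real.exp (inner ℝ t x + δ * ‖t‖) * ‖g t‖) := by
  obtain ⟨δ, hδ, h⟩ := hW.exists_memLp_exp_mul hg hfin hx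
  refine ⟨δ / 2, by positivity, ?_⟩
  have h2 : MemLp (fun t : RSpace n => (Real.exp (-(δ / 2 * ‖t‖)) : ℂ)) 2 := by
    rw [memLp_two_iff_integrable_sq_norm
      (Continuous.aestronglyMeasurable (by fun_prop))]
    refine (integrable_exp_neg_mul_norm volume hδ).congr (Eventually.of_forall fun t => ?_)
    simp only [Complex.norm_real, Real.norm_eq_abs, Real.abs_exp, ← Real.exp_nat_mul]
    congr 1
    push_cast
    ring
  refine (h2.integrable_mul h).norm.congr (Eventually.of_forall fun t => ?_)
  simp only [Pi.mul_apply, norm_mul, Complex.norm_real, Real.norm_eq_abs, Real.abs_exp,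
    ← mul_assoc, ← Real.exp_add]
  ring_nf

lemma IsTubeWeight.memLp_exp_inner_mul (hW : IsTubeWeight D W)
    (hg : AEStronglyMeasurable g volume) (hfin : ∫⁻ t, ‖g t‖ₑ ^ 2 * laplaceWeight W t < ⊤)
    {x : RSpace n} (hx : x ∈ D) :
    MemLp (fun t => (Real.exp (inner ℝ t x) : ℂ) * g t) 2 := by
  obtain ⟨δ, hδ, h⟩ := hW.exists_memLp_exp_mul hg hfin hx
  refine h.mono (aestronglyMeasurable_exp_mul hg (by fun_prop)) (Eventually.of_forall fun t => ?_)
  simp only [norm_mul, Complex.norm_real, Real.norm_eq_abs, Real.abs_exp]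
  gcongr
  have : 0 ≤ δ * ‖t‖ := by positivity
  linarith

lemma aestronglyMeasurable_exp_pairing_mul (hg : AEStronglyMeasurable g volume) (z : CSpace n) :
    AEStronglyMeasurable (fun t => Complex.exp (pairing t z) * g t) volume :=
  (Complex.continuous_exp.comp (continuous_pairing_left z)).aestronglyMeasurable.mul hg

lemma IsTubeWeight.integrable_exp_pairing_mul (hW : IsTubeWeight D W)
    (hg : AEStronglyMeasurable g volume) (hfin : ∫⁻ t, ‖g t‖ₑ ^ 2 * laplaceWeight W t < ⊤)
    {z : CSpace n} (hz : z ∈ tube D) :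
    Integrable fun t => Complex.exp (pairing t z) * g t := by
  obtain ⟨δ, hδ, h⟩ := hW.exists_integrable_exp_mul hg hfin hz
  refine h.mono' (aestronglyMeasurable_exp_pairing_mul hg z) (Eventually.of_forall fun t => ?_)
  rw [norm_mul, norm_exp_pairing]
  gcongr
  have : 0 ≤ δ * ‖t‖ := by positivity
  linarith

lemma IsTubeWeight.differentiableOn_fourierLaplace (hW : IsTubeWeight D W)
    (hg : AEStronglyMeasurable g volume) (hfin : ∫⁻ t, ‖g t‖ₑ ^ 2 * laplaceWeight W t < ⊤) :
    DifferentiableOn ℂ (fourierLaplace g) (tube D) := by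
  intro z hz
  obtain ⟨δ, hδ, h⟩ := hW.exists_integrable_exp_mul hg hfin hz
  refine DifferentiableAt.differentiableWithinAt ?_
  refine (hasFDerivAt_integral_of_dominated_of_fderiv_le (𝕜 := ℂ) (μ := volume)
    (F := fun z t => Complex.exp (pairing t z) * g t)
    (F' := fun z t => g t • Complex.exp (pairing t z) • innerSL ℂ (toComplex t 0)) (x₀ := z)
    (s := Metric.ball z (δ / 2))
    -- Half of `δ` absorbs the displacement of `Re w` from `Re z`. The other half absorbs the factor
    -- `‖t‖` produced by the derivative, through `‖t‖ ≤ (2/δ) e^{δ‖t‖/2}`.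
    (bound := fun t => (2 / δ) * (Real.exp (inner ℝ t (rePart z) + δ * ‖t‖) * ‖g t‖))
    (Metric.ball_mem_nhds z (by positivity))
    (Eventually.of_forall fun w => aestronglyMeasurable_exp_pairing_mul hg w)
    (hW.integrable_exp_pairing_mul hg hfin hz) ?_
    (Eventually.of_forall fun t w hw => ?_) (h.const_mul _)
    (Eventually.of_forall fun t w _ => ?_)).differentiableAt
  · refine hg.smul (Continuous.aestronglyMeasurable ?_)
    exact (Complex.continuous_exp.comp (continuous_pairing_left z)).smul
      ((innerSL ℂ).continuous.comp continuous_toComplex_zero)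
  · rw [norm_smul, norm_smul, innerSL_apply_norm, norm_toComplex_zero, norm_exp_pairing]
    have hw' : ‖w - z‖ < δ / 2 := by simpa [dist_eq_norm] using hw
    have h1 : inner ℝ t (rePart w) ≤ inner ℝ t (rePart z) + δ / 2 * ‖t‖ := by
      have e : inner ℝ t (rePart w) = inner ℝ t (rePart z) + inner ℝ t (rePart (w - z)) := by
        rw [rePart_sub, inner_sub_right]; ring
      have h2 : inner ℝ t (rePart (w - z)) ≤ ‖t‖ * ‖w - z‖ :=
        (real_inner_le_norm _ _).trans
          (mul_le_mul_of_nonneg_left (norm_rePart_le _) (norm_nonneg _))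
      have h3 : ‖t‖ * ‖w - z‖ ≤ ‖t‖ * (δ / 2) :=
        mul_le_mul_of_nonneg_left hw'.le (norm_nonneg _)
      linarith
    have h2 : ‖t‖ ≤ (2 / δ) * Real.exp (δ / 2 * ‖t‖) := by
      have := Real.add_one_le_exp (δ / 2 * ‖t‖)
      rw [div_mul_eq_mul_div, le_div_iff₀ hδ]
      linarith
    calc ‖g t‖ * (Real.exp (inner ℝ t (rePart w)) * ‖t‖)
        ≤ ‖g t‖ * (Real.exp (inner ℝ t (rePart z) + δ / 2 * ‖t‖) *
          ((2 / δ) * Real.exp (δ / 2 * ‖t‖))) := by gcongr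
      _ = 2 / δ * (Real.exp (inner ℝ t (rePart z) + δ * ‖t‖) * ‖g t‖) := by
          rw [show inner ℝ t (rePart z) + δ * ‖t‖ =
            (inner ℝ t (rePart z) + δ / 2 * ‖t‖) + δ / 2 * ‖t‖ by ring,
            Real.exp_add (inner ℝ t (rePart z) + δ / 2 * ‖t‖)]
          ring
  · exact (hasFDerivAt_exp_pairing t w).mul_const (g t)

lemma fourierLaplace_toComplex_smul (g : RSpace n → ℂ) (x w : RSpace n) :
    fourierLaplace g (toComplex x ((2 * Real.pi) • w)) =
      𝓕⁻ (fun t => (Real.exp (inner ℝ t x) : ℂ) * g t) w := by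
  rw [Real.fourierInv_eq']
  refine integral_congr_ae (Eventually.of_forall fun t => ?_)
  simp only [pairing_toComplex, inner_smul_right, smul_eq_mul, Complex.exp_add, ← mul_assoc,
    Complex.ofReal_exp]
  push_cast
  ring

/-- Plancherel's theorem on a vertical slice of the tube. -/
lemma IsTubeWeight.lintegral_slice_fourierLaplace (hW : IsTubeWeight D W)
    (hg : AEStronglyMeasurable g volume) (hfin : ∫⁻ t, ‖g t‖ₑ ^ 2 * laplaceWeight W t < ⊤)
    {x : RSpace n} (hx : x ∈ D) :
    ∫⁻ y, ‖fourierLaplace g (toComplex x y)‖ₑ ^ 2 = ENNReal.ofReal ((2 * Real.pi) ^ n) *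
      ∫⁻ t, ENNReal.ofReal (Real.exp (2 * inner ℝ t x)) * ‖g t‖ₑ ^ 2 := by
  have hint : Integrable fun t => (Real.exp (inner ℝ t x) : ℂ) * g t := by
    have h := hW.integrable_exp_pairing_mul hg hfin (z := toComplex x 0)
      (toComplex_mem_tube.2 hx)
    simpa [pairing_toComplex] using h
  have hcont : Continuous fun y => fourierLaplace g (toComplex x y) :=
    ((hW.differentiableOn_fourierLaplace hg hfin).continuousOn).comp_continuous
      (continuous_const.toComplex continuous_id) fun y => toComplex_mem_tube.2 hx
  rw [lintegral_eq_ofReal_pow_mul_lintegral_comp_smul Real.two_pi_pos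
    (hcont.enorm.measurable.pow_const 2).aemeasurable]
  simp only [fourierLaplace_toComplex_smul]
  rw [lintegral_enorm_sq_fourierInv hint (hW.memLp_exp_inner_mul hg hfin hx)]
  simp only [enorm_ofReal_exp_mul_sq, finrank_euclideanSpace, Fintype.card_fin]

/-- Tonelli, with `W = 0` almost everywhere off `D`. No finiteness is assumed, so the converse
direction can use this to prove that the weighted norm of `g` is finite. -/
lemma IsTubeWeight.lintegral_mul_laplaceWeight (hW : IsTubeWeight D W)
    (hg : AEStronglyMeasurable g volume) :
    ∫⁻ t, ‖g t‖ₑ ^ 2 * laplaceWeight W t =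
      ∫⁻ x in D, (∫⁻ t, ENNReal.ofReal (Real.exp (2 * inner ℝ t x)) * ‖g t‖ₑ ^ 2) * W x := by
  have hexp : Measurable fun p : RSpace n × RSpace n =>
      ENNReal.ofReal (Real.exp (2 * inner ℝ p.1 p.2)) := by fun_prop
  have hg2 : AEMeasurable (fun t => ‖g t‖ₑ ^ 2) (volume : Measure (RSpace n)) :=
    hg.enorm.pow_const 2
  calc ∫⁻ t, ‖g t‖ₑ ^ 2 * laplaceWeight W t
      = ∫⁻ t, ∫⁻ x, ‖g t‖ₑ ^ 2 * (ENNReal.ofReal (Real.exp (2 * inner ℝ t x)) * W x) := by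
        refine lintegral_congr fun t => ?_
        rw [laplaceWeight, lintegral_const_mul' _ _ (by finiteness)]
    _ = ∫⁻ x, ∫⁻ t, ‖g t‖ₑ ^ 2 * (ENNReal.ofReal (Real.exp (2 * inner ℝ t x)) * W x) := by
        refine lintegral_lintegral_swap ?_
        exact hg2.comp_fst.mul (hexp.aemeasurable.mul hW.aemeasurable.comp_snd)
    _ = ∫⁻ x, (∫⁻ t, ENNReal.ofReal (Real.exp (2 * inner ℝ t x)) * ‖g t‖ₑ ^ 2) * W x := by
        refine lintegral_congr fun x => ?_
        rw [← lintegral_mul_const'']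
        · exact lintegral_congr fun t => by ring
        · exact (Measurable.aemeasurable (by fun_prop)).mul hg2
    _ = _ := by
        rw [← lintegral_indicator hW.isOpen.measurableSet]
        refine lintegral_congr_ae ?_
        filter_upwards [hW.ae_eq_zero] with x hx
        by_cases h : x ∈ D
        · simp [h]
        · simp [h, hx h]

lemma IsTubeWeight.lintegral_tube (hW : IsTubeWeight D W) {f : CSpace n → ℂ}
    (hf : ContinuousOn f (tube D)) :
    ∫⁻ p : RSpace n × RSpace n in D ×ˢ univ, ‖f (toComplex p.1 p.2)‖ₑ ^ 2 * W p.1 =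
      ∫⁻ x in D, (∫⁻ y, ‖f (toComplex x y)‖ₑ ^ 2) * W x := by
  have hD := hW.isOpen.measurableSet
  have hcont : ContinuousOn (fun p : RSpace n × RSpace n => ‖f (toComplex p.1 p.2)‖ₑ ^ 2)
      (D ×ˢ univ) :=
    (ENNReal.continuous_pow 2).comp_continuousOn (continuous_enorm.comp_continuousOn
      (hf.comp continuous_toComplex.continuousOn fun p hp => toComplex_mem_tube.2 hp.1))
  have h1 := hcont.aemeasurable (μ := volume) (hD.prod MeasurableSet.univ)
  rw [Measure.volume_eq_prod, ← Measure.prod_restrict, Measure.restrict_univ] at h1 ⊢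
  refine (lintegral_prod _ (h1.mul (hW.aemeasurable.restrict.comp_fst))).trans ?_
  refine setLIntegral_congr_fun hD fun x hx => ?_
  have hy : Continuous fun y => ‖f (toComplex x y)‖ₑ ^ 2 :=
    (ENNReal.continuous_pow 2).comp (continuous_enorm.comp
      (hf.comp_continuous (continuous_const.toComplex continuous_id)
        fun y => toComplex_mem_tube.2 hx))
  exact lintegral_mul_const (W x) hy.measurable

lemma IsTubeWeight.lintegral_tube_fourierLaplace (hW : IsTubeWeight D W)
    (hg : AEStronglyMeasurable g volume) (hfin : ∫⁻ t, ‖g t‖ₑ ^ 2 * laplaceWeight W t < ⊤) :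
    ∫⁻ p : RSpace n × RSpace n in D ×ˢ univ,
        ‖fourierLaplace g (toComplex p.1 p.2)‖ₑ ^ 2 * W p.1 =
      ENNReal.ofReal ((2 * Real.pi) ^ n) * ∫⁻ t, ‖g t‖ₑ ^ 2 * laplaceWeight W t := by
  rw [hW.lintegral_tube (hW.differentiableOn_fourierLaplace hg hfin).continuousOn,
    hW.lintegral_mul_laplaceWeight hg, ← lintegral_const_mul' _ _ ENNReal.ofReal_ne_top]
  refine setLIntegral_congr_fun hW.isOpen.measurableSet fun x hx => ?_
  simp only [hW.lintegral_slice_fourierLaplace hg hfin hx, mul_assoc]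

end FourierLaplace

/-! ### Sub-mean value inequality and local boundedness of Bergman functions -/

section SubmeanValue

variable {n : ℕ} {D : Set (RSpace n)} {W : RSpace n → ENNReal} {f : CSpace n → ℂ}

/-- The mean value property of the holomorphic function `s ↦ f(z + s v)²` on the unit circle,
followed by the triangle inequality for integrals. -/
lemma lintegral_circle_ge_of_differentiableOn (hD : IsOpen D) (hf : DifferentiableOn ℂ f (tube D))
    {z v : CSpace n} (h : ∀ s : ℂ, ‖s‖ ≤ 1 → z + s • v ∈ tube D) :
    ENNReal.ofReal (2 * Real.pi) * ‖f z‖ₑ ^ 2 ≤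
      ∫⁻ θ in Ioc 0 (2 * Real.pi), ‖f (z + circleMap 0 1 θ • v)‖ₑ ^ 2 := by
  have hd : DifferentiableOn ℂ (fun s : ℂ => f (z + s • v) ^ 2) (Metric.closedBall 0 1) := by
    intro s hs
    have h1 : DifferentiableAt ℂ f (z + s • v) :=
      hf.differentiableAt ((isOpen_tube hD).mem_nhds (h s (by simpa using hs)))
    have h2 : DifferentiableAt ℂ (fun s : ℂ => z + s • v) s := by fun_prop
    exact ((DifferentiableAt.comp s h1 h2).pow 2).differentiableWithinAt
  have hc : DiffContOnCl ℂ (fun s : ℂ => f (z + s • v) ^ 2) (Metric.ball 0 |1|) := by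
    rw [abs_one]
    exact (hd.mono Metric.closure_ball_subset_closedBall).diffContOnCl
  have hm := hc.circleAverage
  rw [Real.circleAverage_def, intervalIntegral.integral_of_le Real.two_pi_pos.le] at hm
  have hm' : ∫ θ in Ioc 0 (2 * Real.pi), f (z + circleMap 0 1 θ • v) ^ 2 =
      ((2 * Real.pi : ℝ) : ℂ) * f z ^ 2 := by
    have hpi : (2 * Real.pi) ≠ 0 := Real.two_pi_pos.ne'
    simp only [zero_smul, add_zero] at hm
    rw [← hm, ← Complex.real_smul, smul_inv_smul₀ hpi]
  calc ENNReal.ofReal (2 * Real.pi) * ‖f z‖ₑ ^ 2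
      = ‖((2 * Real.pi : ℝ) : ℂ) * f z ^ 2‖ₑ := by
        rw [enorm_mul, enorm_pow, ← ofReal_norm ((2 * Real.pi : ℝ) : ℂ), Complex.norm_real,
          Real.norm_of_nonneg Real.two_pi_pos.le]
    _ ≤ ∫⁻ θ in Ioc 0 (2 * Real.pi), ‖f (z + circleMap 0 1 θ • v) ^ 2‖ₑ := by
        rw [← hm']
        exact enorm_integral_le_lintegral_enorm _
    _ = _ := by simp only [enorm_pow]

/-- Multiplication by `e^{iθ}` on `ℂⁿ = ℝⁿ × ℝⁿ`. -/
def phaseRotation (n : ℕ) (θ : ℝ) : RSpace n × RSpace n →ₗ[ℝ] RSpace n × RSpace n where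
  toFun p := (Real.cos θ • p.1 - Real.sin θ • p.2, Real.sin θ • p.1 + Real.cos θ • p.2)
  map_add' p q := by ext <;> simp <;> ring
  map_smul' c p := by ext <;> simp <;> ring

lemma toComplex_phaseRotation (θ : ℝ) (p : RSpace n × RSpace n) :
    toComplex (phaseRotation n θ p).1 (phaseRotation n θ p).2 =
      circleMap 0 1 θ • toComplex p.1 p.2 := by
  ext j
  simp only [phaseRotation, LinearMap.coe_mk, AddHom.coe_mk, toComplex_apply, PiLp.sub_apply,
    PiLp.add_apply, PiLp.smul_apply, smul_eq_mul, circleMap, Complex.exp_mul_I]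
  push_cast
  linear_combination (-(p.2 j : ℂ) * Complex.sin θ) * Complex.I_sq

lemma phaseRotation_neg_comp (θ : ℝ) :
    phaseRotation n (-θ) ∘ₗ phaseRotation n θ = LinearMap.id := by
  refine LinearMap.ext fun p => ?_
  have h := Real.sin_sq_add_cos_sq θ
  simp only [phaseRotation, LinearMap.coe_comp, LinearMap.coe_mk, AddHom.coe_mk,
    Function.comp_apply, Real.cos_neg, Real.sin_neg, LinearMap.id_apply]
  ext j
  · simp
    linear_combination (p.1 j) * h
  · simp
    linear_combination (p.2 j) * h

/-- The Euclidean ball of `ℂⁿ = ℝⁿ × ℝⁿ` about the origin. -/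
def complexBall (n : ℕ) (r : ℝ) : Set (RSpace n × RSpace n) :=
  {p | ‖toComplex p.1 p.2‖ < r}

lemma isOpen_complexBall (r : ℝ) : IsOpen (complexBall n r) :=
  isOpen_lt continuous_toComplex.norm continuous_const

lemma phaseRotation_preimage_complexBall (θ r : ℝ) :
    phaseRotation n θ ⁻¹' complexBall n r = complexBall n r := by
  ext p
  simp [complexBall, toComplex_phaseRotation, norm_smul]

lemma volume_complexBall_ne_zero {r : ℝ} (hr : 0 < r) : volume (complexBall n r) ≠ 0 := by
  refine ((isOpen_complexBall r).measure_pos volume ⟨0, ?_⟩).ne'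
  have : toComplex (0 : RSpace n) 0 = 0 := by ext j; simp
  simpa [complexBall, this] using hr

lemma volume_complexBall_ne_top (r : ℝ) : volume (complexBall n r) ≠ ⊤ := by
  refine ((measure_mono ?_).trans_lt (measure_ball_lt_top (x := 0) (r := r))).ne
  intro p hp
  have h1 := norm_rePart_le (toComplex p.1 p.2)
  have h2 := norm_imPart_le (toComplex p.1 p.2)
  rw [rePart_toComplex] at h1
  rw [imPart_toComplex] at h2
  have hp' : ‖toComplex p.1 p.2‖ < r := hp
  rw [mem_ball_zero_iff, Prod.norm_def, max_lt_iff]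
  exact ⟨h1.trans_lt hp', h2.trans_lt hp'⟩

/-- The determinant need not be computed: an invertible linear map scales volume by a constant, and
this constant is `1` because the unit ball, of positive finite volume, is its own preimage. -/
lemma measurePreserving_phaseRotation (θ : ℝ) :
    MeasurePreserving (phaseRotation n θ) volume volume := by
  have hmeas : Measurable (phaseRotation n θ) :=
    (LinearMap.continuous_of_finiteDimensional _).measurable
  have hdet : LinearMap.det (phaseRotation n θ) ≠ 0 := by
    intro h
    have := congrArg LinearMap.det (phaseRotation_neg_comp (n := n) θ)
    rw [LinearMap.det_comp, h] at this
    simp at this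
  refine ⟨hmeas, ?_⟩
  have : (volume : Measure (RSpace n × RSpace n)).IsAddHaarMeasure := by
    rw [Measure.volume_eq_prod]; infer_instance
  have hmap := Measure.map_linearMap_addHaar_eq_smul_addHaar
    (volume : Measure (RSpace n × RSpace n)) hdet
  have h1 := congrArg (fun μ => μ (complexBall n 1)) hmap
  simp only [Measure.smul_apply, smul_eq_mul] at h1
  rw [Measure.map_apply hmeas (isOpen_complexBall 1).measurableSet,
    phaseRotation_preimage_complexBall] at h1
  have hc : ENNReal.ofReal |(LinearMap.det (phaseRotation n θ))⁻¹| = 1 :=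
    (ENNReal.mul_eq_right (volume_complexBall_ne_zero one_pos) (volume_complexBall_ne_top 1)).1
      h1.symm
  rw [hmap, hc, one_smul]

lemma add_smul_mem_tube {x y : RSpace n} {r : ℝ} (hD : Metric.ball x r ⊆ D)
    {p : RSpace n × RSpace n} (hp : p ∈ complexBall n r) {s : ℂ} (hs : ‖s‖ ≤ 1) :
    toComplex x y + s • toComplex p.1 p.2 ∈ tube D := by
  refine hD ?_
  rw [Metric.mem_ball, dist_eq_norm]
  have : rePart (toComplex x y + s • toComplex p.1 p.2) - x =
      rePart (s • toComplex p.1 p.2) := by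
    ext j; simp
  rw [this]
  refine (norm_rePart_le _).trans_lt ?_
  rw [norm_smul]
  exact (mul_le_of_le_one_left (norm_nonneg _) hs).trans_lt hp

/-- The sub-mean value inequality for `|f|²` on Euclidean balls of `ℂⁿ`. -/
lemma volume_mul_enorm_sq_le (hDo : IsOpen D) (hf : DifferentiableOn ℂ f (tube D))
    {x : RSpace n} {r : ℝ} (hD : Metric.ball x r ⊆ D) (y : RSpace n) :
    volume (complexBall n r) * ‖f (toComplex x y)‖ₑ ^ 2 ≤
      ∫⁻ p in complexBall n r, ‖f (toComplex (x + p.1) (y + p.2))‖ₑ ^ 2 := by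
  set z := toComplex x y with hz
  -- Extending `|f|²` by zero off the tube makes it measurable everywhere, as the interchange of
  -- integrals requires.
  set q : CSpace n → ENNReal := (tube D).indicator fun w => ‖f w‖ₑ ^ 2 with hq
  have hqm : Measurable q := by
    refine ContinuousOn.measurable_indicator ?_ (isOpen_tube hDo).measurableSet
    exact (ENNReal.continuous_pow 2).comp_continuousOn
      (continuous_enorm.comp_continuousOn hf.continuousOn)
  have hBm := (isOpen_complexBall (n := n) r).measurableSet
  have hqf : ∀ p ∈ complexBall n r, ∀ s : ℂ, ‖s‖ ≤ 1 →
      q (z + s • toComplex p.1 p.2) = ‖f (z + s • toComplex p.1 p.2)‖ₑ ^ 2 := fun p hp s hs =>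
    indicator_of_mem (add_smul_mem_tube hD hp hs) _
  have hjoint : Measurable fun a : (RSpace n × RSpace n) × ℝ =>
      q (z + circleMap 0 1 a.2 • toComplex a.1.1 a.1.2) := by
    refine hqm.comp (Continuous.measurable ?_)
    exact continuous_const.add (((continuous_circleMap 0 1).comp continuous_snd).smul
      (continuous_toComplex.comp continuous_fst))
  -- The rotation by `θ` preserves the ball and its measure, so after the interchange the inner
  -- integral does not depend on `θ`.
  have hcirc : ∀ θ, ∫⁻ p in complexBall n r, q (z + circleMap 0 1 θ • toComplex p.1 p.2) =
      ∫⁻ p in complexBall n r, q (z + toComplex p.1 p.2) := by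
    intro θ
    have h := (measurePreserving_phaseRotation (n := n) θ).setLIntegral_comp_preimage hBm
      (f := fun p => q (z + toComplex p.1 p.2))
      (hqm.comp (continuous_const.add continuous_toComplex).measurable)
    simp only [phaseRotation_preimage_complexBall, toComplex_phaseRotation] at h
    exact h
  have h2pi : ENNReal.ofReal (2 * Real.pi) ≠ 0 := by simpa using Real.pi_pos
  refine (ENNReal.mul_le_mul_iff_right h2pi ENNReal.ofReal_ne_top).1 ?_
  calc ENNReal.ofReal (2 * Real.pi) * (volume (complexBall n r) * ‖f z‖ₑ ^ 2)
      = ∫⁻ _ in complexBall n r, ENNReal.ofReal (2 * Real.pi) * ‖f z‖ₑ ^ 2 := by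
        rw [setLIntegral_const]; ring
    _ ≤ ∫⁻ p in complexBall n r, ∫⁻ θ in Ioc 0 (2 * Real.pi),
          q (z + circleMap 0 1 θ • toComplex p.1 p.2) := by
        refine setLIntegral_mono' hBm fun p hp => ?_
        refine (lintegral_circle_ge_of_differentiableOn hDo hf
          fun s hs => add_smul_mem_tube hD hp hs).trans (lintegral_mono fun θ => ?_)
        rw [hqf p hp _ (by simp)]
    _ = ∫⁻ θ in Ioc 0 (2 * Real.pi), ∫⁻ p in complexBall n r,
          q (z + circleMap 0 1 θ • toComplex p.1 p.2) :=
        lintegral_lintegral_swap hjoint.aemeasurable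
    _ = ENNReal.ofReal (2 * Real.pi) * ∫⁻ p in complexBall n r, q (z + toComplex p.1 p.2) := by
        simp only [hcirc]
        rw [lintegral_const, Measure.restrict_apply_univ, Real.volume_Ioc, sub_zero, mul_comm]
    _ = _ := by
        congr 1
        refine setLIntegral_congr_fun hBm fun p hp => ?_
        have := hqf p hp 1 (by simp)
        simp only [one_smul] at this
        rw [this, hz, ← toComplex_add]

/-- A function in a weighted Bergman space of a tube is bounded over small balls of the base. -/
lemma IsTubeWeight.exists_norm_le (hW : IsTubeWeight D W) (hf : DifferentiableOn ℂ f (tube D))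
    (hfin : ∫⁻ p : RSpace n × RSpace n in D ×ˢ univ,
      ‖f (toComplex p.1 p.2)‖ₑ ^ 2 * W p.1 < ⊤) {x₀ : RSpace n} (hx₀ : x₀ ∈ D) :
    ∃ r > 0, Metric.ball x₀ r ⊆ D ∧ ∃ M, ∀ x ∈ Metric.ball x₀ r, ∀ y,
      ‖f (toComplex x y)‖ ≤ M := by
  obtain ⟨R, hR, c, hc, hRD, hle⟩ := hW.exists_le x₀ hx₀
  set I := ∫⁻ p : RSpace n × RSpace n in D ×ˢ univ, ‖f (toComplex p.1 p.2)‖ₑ ^ 2 * W p.1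
  -- Balls of radius `R/2` centred in `ball x₀ (R/2)` stay in `ball x₀ R`, where `W ≥ c`.
  set r := R / 2 with hr
  have hr0 : 0 < r := by positivity
  set V := volume (complexBall n r) * ENNReal.ofReal c with hV
  have hV0 : V ≠ 0 := mul_ne_zero (volume_complexBall_ne_zero hr0) (by simpa using hc)
  refine ⟨r, hr0, (Metric.ball_subset_ball (by linarith)).trans hRD,
    Real.sqrt (I / V).toReal, fun x hx y => ?_⟩
  have hball : Metric.ball x r ⊆ Metric.ball x₀ R := by
    refine Metric.ball_subset_ball' ?_
    have : dist x x₀ < r := hx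
    linarith
  have hmem : ∀ p ∈ complexBall n r, x + p.1 ∈ Metric.ball x₀ R := fun p hp => by
    have := add_smul_mem_tube (y := y) hball hp (s := 1) (by simp)
    rw [one_smul, ← toComplex_add] at this
    exact toComplex_mem_tube.1 this
  have key : V * ‖f (toComplex x y)‖ₑ ^ 2 ≤ I := by
    calc V * ‖f (toComplex x y)‖ₑ ^ 2
        = (volume (complexBall n r) * ‖f (toComplex x y)‖ₑ ^ 2) * ENNReal.ofReal c := by
          rw [hV]; ring
      _ ≤ (∫⁻ p in complexBall n r, ‖f (toComplex (x + p.1) (y + p.2))‖ₑ ^ 2) *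
            ENNReal.ofReal c := by
          gcongr
          exact volume_mul_enorm_sq_le hW.isOpen hf (hball.trans hRD) y
      _ = ∫⁻ p in complexBall n r, ‖f (toComplex (x + p.1) (y + p.2))‖ₑ ^ 2 *
            ENNReal.ofReal c := (lintegral_mul_const' _ _ ENNReal.ofReal_ne_top).symm
      _ ≤ ∫⁻ p in complexBall n r, (D ×ˢ univ).indicator
            (fun p => ‖f (toComplex p.1 p.2)‖ₑ ^ 2 * W p.1) ((x, y) + p) := by
          refine setLIntegral_mono' (isOpen_complexBall r).measurableSet fun p hp => ?_
          rw [indicator_of_mem]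
          · exact mul_le_mul_right (hle _ (hmem p hp)) _
          · exact ⟨hRD (hmem p hp), mem_univ _⟩
      _ ≤ ∫⁻ p, (D ×ˢ univ).indicator
            (fun p => ‖f (toComplex p.1 p.2)‖ₑ ^ 2 * W p.1) ((x, y) + p) :=
          setLIntegral_le_lintegral _ _
      _ = I := by
          have : (volume : Measure (RSpace n × RSpace n)).IsAddLeftInvariant := by
            rw [Measure.volume_eq_prod]; infer_instance
          rw [lintegral_add_left_eq_self,
            lintegral_indicator (hW.isOpen.measurableSet.prod MeasurableSet.univ)]
  have hVt : V ≠ ⊤ := ENNReal.mul_ne_top (volume_complexBall_ne_top r) ENNReal.ofReal_ne_top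
  have h2 : ‖f (toComplex x y)‖ₑ ^ 2 ≤ I / V := by
    rw [ENNReal.le_div_iff_mul_le (Or.inl hV0) (Or.inl hVt), mul_comm]
    exact key
  refine Real.le_sqrt_of_sq_le ?_
  have h3 := ENNReal.toReal_mono (ENNReal.div_lt_top hfin.ne hV0).ne h2
  rwa [ENNReal.toReal_pow, toReal_enorm] at h3

end SubmeanValue

/-! ### Cauchy's theorem for vertical slices -/

section VerticalShift

variable {n : ℕ} {D : Set (RSpace n)} {F : CSpace n → ℂ}

/-- `F` decays exponentially in the vertical directions of the tube over `D`, locally uniformly. -/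
def HasVerticalDecay (D : Set (RSpace n)) (F : CSpace n → ℂ) : Prop :=
  ∀ x₀ ∈ D, ∃ r > 0, Metric.ball x₀ r ⊆ D ∧ ∃ C ≥ 0, ∃ ε > 0, ∀ x ∈ Metric.ball x₀ r, ∀ y,
    ‖F (toComplex x y)‖ ≤ C * Real.exp (-(ε * ‖y‖))

lemma continuous_slice (hF : ContinuousOn F (tube D)) {x : RSpace n} (hx : x ∈ D) :
    Continuous fun y => F (toComplex x y) :=
  hF.comp_continuous (continuous_const.toComplex continuous_id) fun _ => toComplex_mem_tube.2 hx

lemma HasVerticalDecay.integrable (h : HasVerticalDecay D F) (hF : ContinuousOn F (tube D))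
    {x : RSpace n} (hx : x ∈ D) : Integrable fun y => F (toComplex x y) := by
  obtain ⟨r, hr, -, C, -, ε, hε, hb⟩ := h x hx
  exact ((integrable_exp_neg_mul_norm volume hε).const_mul C).mono'
    (continuous_slice hF hx).aestronglyMeasurable
    (Eventually.of_forall fun y => hb x (Metric.mem_ball_self hr) y)

lemma toComplex_add_smul_add (x v y : RSpace n) (s : ℂ) :
    toComplex x y + s • toComplex v 0 = toComplex (x + s.re • v) (y + s.im • v) := by
  ext j
  apply Complex.ext <;> simp

lemma add_smul_mem_tube_iff {x v y : RSpace n} {s : ℂ} :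
    toComplex x y + s • toComplex v 0 ∈ tube D ↔ x + s.re • v ∈ D := by
  rw [toComplex_add_smul_add, toComplex_mem_tube]

/-- Differentiation under the integral sign. Only `F` itself is assumed to decay; Cauchy's estimate
on discs of radius `ρ` transfers the bound to the derivative. -/
lemma HasVerticalDecay.exists_hasDerivAt (h : HasVerticalDecay D F) (hD : IsOpen D)
    (hF : DifferentiableOn ℂ F (tube D)) {x v : RSpace n} {s₀ : ℂ} (hs₀ : x + s₀.re • v ∈ D) :
    ∃ d, HasDerivAt (fun s : ℂ => ∫ y, F (toComplex x y + s • toComplex v 0)) d s₀ := by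
  obtain ⟨r, hr, hrD, C, hC, ε, hε, hb⟩ := h _ hs₀
  -- Makes `2ρ‖v‖ < r`, so the base point stays in the ball of decay for `s` within `2ρ` of `s₀`;
  -- the `+ 1` covers `v = 0`.
  set ρ := r / (2 * (‖v‖ + 1)) with hρ
  have hv1 : 0 < ‖v‖ + 1 := by positivity
  have hρ0 : 0 < ρ := by positivity
  have hρv : 2 * ρ * ‖v‖ < r := by
    have : 2 * ρ * (‖v‖ + 1) = r := by rw [hρ]; field_simp
    nlinarith
  -- Bounds the vertical displacement `‖s.im • v‖`, which costs a factor `e^{εK}` in the decay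
  -- estimate.
  set K := (|s₀.im| + 2 * ρ) * ‖v‖ with hK
  have hnear : ∀ s ∈ Metric.ball s₀ (2 * ρ), x + s.re • v ∈ Metric.ball (x + s₀.re • v) r := by
    intro s hs
    have hs' : ‖s - s₀‖ < 2 * ρ := by simpa [dist_eq_norm] using hs
    have e : x + s.re • v - (x + s₀.re • v) = (s - s₀).re • v := by
      rw [Complex.sub_re, sub_smul]; abel
    rw [Metric.mem_ball, dist_eq_norm, e, norm_smul, Real.norm_eq_abs]
    exact (mul_le_mul_of_nonneg_right ((Complex.abs_re_le_norm _).trans hs'.le)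
      (norm_nonneg _)).trans_lt hρv
  have hdiff : ∀ s ∈ Metric.ball s₀ (2 * ρ), ∀ y,
      HasDerivAt (fun s : ℂ => F (toComplex x y + s • toComplex v 0))
        (fderiv ℂ F (toComplex x y + s • toComplex v 0) (toComplex v 0)) s := by
    intro s hs y
    have h1 : HasFDerivAt F (fderiv ℂ F (toComplex x y + s • toComplex v 0))
        (toComplex x y + s • toComplex v 0) :=
      (hF.differentiableAt ((isOpen_tube hD).mem_nhds
        (add_smul_mem_tube_iff.2 (hrD (hnear s hs))))).hasFDerivAt
    have h2 : HasDerivAt (fun s : ℂ => toComplex x y + s • toComplex v 0) (toComplex v 0) s := by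
      simpa using ((hasDerivAt_id s).smul_const (toComplex v 0)).const_add (toComplex x y)
    exact h1.comp_hasDerivAt s h2
  have hbound : ∀ s ∈ Metric.ball s₀ (2 * ρ), ∀ y,
      ‖F (toComplex x y + s • toComplex v 0)‖ ≤
        C * Real.exp (ε * K) * Real.exp (-(ε * ‖y‖)) := by
    intro s hs y
    have hs' : ‖s - s₀‖ < 2 * ρ := by simpa [dist_eq_norm] using hs
    have him : |s.im| ≤ |s₀.im| + 2 * ρ := by
      have h1 : |s.im - s₀.im| ≤ ‖s - s₀‖ := by
        simpa using Complex.abs_im_le_norm (s - s₀)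
      have h2 := abs_sub_abs_le_abs_sub s.im s₀.im
      linarith
    have hy : ‖y‖ ≤ ‖y + s.im • v‖ + K := by
      have h1 : ‖y‖ ≤ ‖y + s.im • v‖ + ‖s.im • v‖ := by
        simpa using norm_sub_le (y + s.im • v) (s.im • v)
      have h2 : ‖s.im • v‖ ≤ K := by
        rw [norm_smul, Real.norm_eq_abs]
        exact mul_le_mul_of_nonneg_right him (norm_nonneg _)
      linarith
    rw [toComplex_add_smul_add]
    refine (hb _ (hnear s hs) _).trans ?_
    rw [mul_assoc, ← Real.exp_add]
    gcongr
    nlinarith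
  have hmeas : ∀ s ∈ Metric.ball s₀ (2 * ρ), AEStronglyMeasurable
      (fun y => F (toComplex x y + s • toComplex v 0)) volume := fun s hs =>
    (hF.continuousOn.comp_continuous
      ((continuous_const.toComplex continuous_id).add continuous_const)
      fun _ => add_smul_mem_tube_iff.2 (hrD (hnear s hs))).aestronglyMeasurable
  have hint := (integrable_exp_neg_mul_norm (volume : Measure (RSpace n)) hε).const_mul
    (C * Real.exp (ε * K))
  have hs₀mem : s₀ ∈ Metric.ball s₀ (2 * ρ) := Metric.mem_ball_self (by positivity)
  refine ⟨_, (hasDerivAt_integral_of_dominated_loc_of_deriv_le (𝕜 := ℂ) (μ := volume)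
    (F := fun s y => F (toComplex x y + s • toComplex v 0))
    (F' := fun s y => fderiv ℂ F (toComplex x y + s • toComplex v 0) (toComplex v 0))
    (x₀ := s₀) (s := Metric.ball s₀ ρ)
    (bound := fun y => C * Real.exp (ε * K) * Real.exp (-(ε * ‖y‖)) / ρ)
    (Metric.ball_mem_nhds s₀ hρ0) ?_ ?_ ?_ ?_ (hint.div_const ρ) ?_).2⟩
  · exact Filter.mem_of_superset (Metric.ball_mem_nhds s₀ (by positivity)) hmeas
  · exact hint.mono' (hmeas s₀ hs₀mem) (Eventually.of_forall (hbound s₀ hs₀mem))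
  · exact ((measurable_fderiv_apply_const ℂ F (toComplex v 0)).comp
      ((continuous_const.toComplex continuous_id).add
        continuous_const).measurable).aestronglyMeasurable
  · refine Eventually.of_forall fun y s hs => ?_
    have hsub : Metric.closedBall s ρ ⊆ Metric.ball s₀ (2 * ρ) := by
      refine Metric.closedBall_subset_ball' ?_
      have : dist s s₀ < ρ := hs
      linarith
    have hd : DifferentiableOn ℂ (fun s : ℂ => F (toComplex x y + s • toComplex v 0))
        (Metric.closedBall s ρ) := fun w hw =>
      (hdiff w (hsub hw) y).differentiableAt.differentiableWithinAt
    rw [← (hdiff s (hsub (Metric.mem_closedBall_self hρ0.le)) y).deriv]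
    exact Complex.norm_deriv_le_of_forall_mem_sphere_norm_le hρ0
      (hd.mono Metric.closure_ball_subset_closedBall).diffContOnCl
      fun w hw => hbound w (hsub (Metric.sphere_subset_closedBall hw)) y
  · exact Eventually.of_forall fun y s hs =>
      hdiff s (Metric.ball_subset_ball (by linarith) hs) y

/-- Cauchy's theorem in a tube: the integral of a holomorphic function over a vertical slice does
not depend on the slice. -/
lemma HasVerticalDecay.integral_slice_eq (h : HasVerticalDecay D F) (hD : IsOpen D)
    (hconv : Convex ℝ D) (hF : DifferentiableOn ℂ F (tube D)) {x x' : RSpace n} (hx : x ∈ D)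
    (hx' : x' ∈ D) : ∫ y, F (toComplex x y) = ∫ y, F (toComplex x' y) := by
  set v := x' - x with hv
  set S : Set ℂ := {s | x + s.re • v ∈ D} with hS
  set H : ℂ → ℂ := fun s => ∫ y, F (toComplex x y + s • toComplex v 0) with hH
  -- Translation invariance in `y` makes `H` depend on `Re s` alone. A holomorphic function that is
  -- constant in the imaginary direction has zero derivative, hence is constant on the convex set
  -- `S`.
  have hHre : ∀ s, H s = ∫ y, F (toComplex (x + s.re • v) y) := by
    intro s
    simp only [hH, toComplex_add_smul_add]
    exact integral_add_right_eq_self (fun y => F (toComplex (x + s.re • v) y)) (s.im • v)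
  have hSo : IsOpen S := hD.preimage (by fun_prop)
  have hSc : Convex ℝ S := by
    intro s hs s' hs' a b ha hb hab
    have e : x + (a • s + b • s').re • v = a • (x + s.re • v) + b • (x + s'.re • v) := by
      obtain rfl : b = 1 - a := by linarith
      simp only [Complex.add_re, Complex.real_smul, Complex.re_ofReal_mul]
      module
    change x + (a • s + b • s').re • v ∈ D
    rw [e]
    exact hconv hs hs' ha hb hab
  have hdH : DifferentiableOn ℂ H S := fun s hs => by
    obtain ⟨d, hd⟩ := h.exists_hasDerivAt hD hF (show x + s.re • v ∈ D from hs)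
    exact hd.differentiableAt.differentiableWithinAt
  have hd0 : EqOn (deriv H) 0 S := by
    intro s hs
    obtain ⟨d, hd⟩ := h.exists_hasDerivAt hD hF (show x + s.re • v ∈ D from hs)
    have h1 : HasDerivAt (fun τ : ℝ => s + (τ : ℂ) * Complex.I) Complex.I 0 := by
      simpa using ((Complex.ofRealCLM.hasDerivAt (x := (0 : ℝ))).mul_const Complex.I).const_add s
    have hd' : HasDerivAt H d (s + ((0 : ℝ) : ℂ) * Complex.I) := by simpa using hd
    have h2 := hd'.scomp (0 : ℝ) h1
    have h3 : H ∘ (fun τ : ℝ => s + (τ : ℂ) * Complex.I) = fun _ => H s := by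
      funext τ
      simp only [Function.comp_apply, hHre]
      simp
    rw [h3] at h2
    have h4 := h2.unique (hasDerivAt_const (0 : ℝ) (H s))
    have h5 : d = 0 := by simpa using h4
    rw [Pi.zero_apply, ← h5]
    exact hd.deriv
  have h0 : (0 : ℂ) ∈ S := by simpa [hS] using hx
  have h1 : (1 : ℂ) ∈ S := by simpa [hS, hv] using hx'
  have := hSo.is_const_of_deriv_eq_zero hSc.isPreconnected hdH hd0 h0 h1
  rw [hHre, hHre] at this
  simpa [hv] using this

end VerticalShift

/-! ### Gaussian regularization: the slice transforms do not depend on the slice -/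

section GaussianRegularization

open FourierTransform

variable {n : ℕ} {D : Set (RSpace n)} {W : RSpace n → ENNReal} {f : CSpace n → ℂ}

/-- The entire function `e^{ε z · z}`, which decays rapidly in vertical directions. -/
def gaussianFactor (ε : ℝ) (z : CSpace n) : ℂ :=
  Complex.exp (ε * ∑ j, z j ^ 2)

lemma differentiable_gaussianFactor (ε : ℝ) :
    Differentiable ℂ (gaussianFactor ε : CSpace n → ℂ) := by
  unfold gaussianFactor
  fun_prop

lemma norm_gaussianFactor (ε : ℝ) (x y : RSpace n) :
    ‖gaussianFactor ε (toComplex x y)‖ = Real.exp (ε * (‖x‖ ^ 2 - ‖y‖ ^ 2)) := by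
  rw [gaussianFactor, Complex.norm_exp, Complex.re_ofReal_mul, Complex.re_sum,
    EuclideanSpace.norm_sq_eq, EuclideanSpace.norm_sq_eq, ← Finset.sum_sub_distrib]
  congr 2
  refine Finset.sum_congr rfl fun j _ => ?_
  simp [pow_two]

/-- Over a bounded set of `x`, both `e^{-t·z}` and `f` are bounded and the Gaussian factor is
`O(e^{-ε‖y‖²})`. The `+ 1` in the constant comes from `‖y‖ ≤ ‖y‖² + 1`. -/
lemma hasVerticalDecay_gaussianFactor
    (hb : ∀ x₀ ∈ D, ∃ r > 0, Metric.ball x₀ r ⊆ D ∧ ∃ M, ∀ x ∈ Metric.ball x₀ r, ∀ y,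
      ‖f (toComplex x y)‖ ≤ M) {ε : ℝ} (hε : 0 < ε) (t : RSpace n) :
    HasVerticalDecay D fun z => Complex.exp (-pairing t z) * (f z * gaussianFactor ε z) := by
  intro x₀ hx₀
  obtain ⟨r, hr, hrD, M, hM⟩ := hb x₀ hx₀
  have hM0 : 0 ≤ M := (norm_nonneg _).trans (hM x₀ (Metric.mem_ball_self hr) 0)
  refine ⟨r, hr, hrD, Real.exp (‖t‖ * (‖x₀‖ + r)) * (M * Real.exp (ε * ((‖x₀‖ + r) ^ 2 + 1))),
    by positivity, ε, hε, fun x hx y => ?_⟩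
  have hx' : ‖x‖ ≤ ‖x₀‖ + r := by
    have h1 : ‖x - x₀‖ < r := by simpa [dist_eq_norm] using hx
    have h2 := norm_sub_norm_le x x₀
    linarith
  have h1 : ‖Complex.exp (-pairing t (toComplex x y))‖ ≤ Real.exp (‖t‖ * (‖x₀‖ + r)) := by
    rw [Complex.norm_exp, Complex.neg_re, re_pairing, rePart_toComplex]
    have := neg_le_of_abs_le (abs_real_inner_le_norm t x)
    gcongr
    nlinarith [norm_nonneg t]
  have h2 : ‖gaussianFactor ε (toComplex x y)‖ ≤
      Real.exp (ε * ((‖x₀‖ + r) ^ 2 + 1)) * Real.exp (-(ε * ‖y‖)) := by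
    rw [norm_gaussianFactor, ← Real.exp_add]
    have h3 : ‖x‖ ^ 2 ≤ (‖x₀‖ + r) ^ 2 := pow_le_pow_left₀ (norm_nonneg _) hx' 2
    have h4 : ‖y‖ ≤ ‖y‖ ^ 2 + 1 := by nlinarith [sq_nonneg (‖y‖ - 1), norm_nonneg y]
    gcongr
    nlinarith
  rw [norm_mul, norm_mul]
  calc _ ≤ Real.exp (‖t‖ * (‖x₀‖ + r)) * (M * (Real.exp (ε * ((‖x₀‖ + r) ^ 2 + 1)) *
        Real.exp (-(ε * ‖y‖)))) := by
        gcongr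
        exact hM x hx y
    _ = _ := by ring

/-- The vertical slice of `f` over `x`, in the normalisation of the Fourier transform. -/
def scaledSlice (f : CSpace n → ℂ) (x : RSpace n) (w : RSpace n) : ℂ :=
  f (toComplex x ((2 * Real.pi) • w))

lemma continuous_scaledSlice (hf : ContinuousOn f (tube D)) {x : RSpace n} (hx : x ∈ D) :
    Continuous (scaledSlice f x) :=
  (continuous_slice hf hx).comp (continuous_const_smul _)

/-- Exhibits the transform of a slice as `e^{t·x}` times a slice integral of `e^{-t·z} F(z)`, the
form to which Cauchy's theorem applies. -/
lemma fourier_scaledSlice (F : CSpace n → ℂ) (x t : RSpace n) :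
    𝓕 (scaledSlice F x) t = (Real.exp (inner ℝ t x) : ℂ) *
      (((2 * Real.pi) ^ n)⁻¹ • ∫ y, Complex.exp (-pairing t (toComplex x y)) *
        F (toComplex x y)) := by
  have h := Measure.integral_comp_smul_of_nonneg (volume : Measure (RSpace n))
    (fun y => Complex.exp (-pairing t (toComplex x y)) * F (toComplex x y)) (2 * Real.pi)
    (hR := Real.two_pi_pos.le)
  rw [finrank_euclideanSpace, Fintype.card_fin] at h
  rw [← h, ← integral_const_mul, Real.fourier_eq']
  refine integral_congr_ae (Eventually.of_forall fun w => ?_)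
  simp only [pairing_toComplex, scaledSlice, smul_eq_mul, ← mul_assoc, Complex.ofReal_exp,
    ← Complex.exp_add, inner_smul_right, real_inner_comm t w]
  congr 2
  push_cast
  ring

lemma differentiableOn_exp_mul_gaussianFactor (hf : DifferentiableOn ℂ f (tube D)) (ε : ℝ)
    (t : RSpace n) : DifferentiableOn ℂ
      (fun z => Complex.exp (-pairing t z) * (f z * gaussianFactor ε z)) (tube D) := by
  have h : Differentiable ℂ fun z : CSpace n => Complex.exp (-pairing t z) := by
    unfold pairing
    fun_prop
  exact h.differentiableOn.mul (hf.mul (differentiable_gaussianFactor ε).differentiableOn)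

lemma exp_neg_mul_fourier_scaledSlice_eq (hD : IsOpen D) (hconv : Convex ℝ D)
    (hf : DifferentiableOn ℂ f (tube D))
    (hb : ∀ x₀ ∈ D, ∃ r > 0, Metric.ball x₀ r ⊆ D ∧ ∃ M, ∀ x ∈ Metric.ball x₀ r, ∀ y,
      ‖f (toComplex x y)‖ ≤ M) {ε : ℝ} (hε : 0 < ε)
    {x x' : RSpace n} (hx : x ∈ D) (hx' : x' ∈ D) (t : RSpace n) :
    (Real.exp (-inner ℝ t x) : ℂ) * 𝓕 (scaledSlice (fun z => f z * gaussianFactor ε z) x) t =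
      (Real.exp (-inner ℝ t x') : ℂ) *
        𝓕 (scaledSlice (fun z => f z * gaussianFactor ε z) x') t := by
  have h := (hasVerticalDecay_gaussianFactor hb hε t).integral_slice_eq hD hconv
    (differentiableOn_exp_mul_gaussianFactor hf ε t) hx hx'
  have hc : ∀ a : ℝ, ((Real.exp (-a) : ℝ) : ℂ) * (Real.exp a : ℝ) = 1 := fun a => by
    rw [← Complex.ofReal_mul, ← Real.exp_add]; simp
  rw [fourier_scaledSlice, fourier_scaledSlice, ← mul_assoc, ← mul_assoc, hc, hc, h]

lemma integrable_scaledSlice_mul_gaussianFactor (hf : DifferentiableOn ℂ f (tube D))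
    (hb : ∀ x₀ ∈ D, ∃ r > 0, Metric.ball x₀ r ⊆ D ∧ ∃ M, ∀ x ∈ Metric.ball x₀ r, ∀ y,
      ‖f (toComplex x y)‖ ≤ M)
    {ε : ℝ} (hε : 0 < ε) {x : RSpace n}
    (hx : x ∈ D) : Integrable (scaledSlice (fun z => f z * gaussianFactor ε z) x) := by
  have h := (hasVerticalDecay_gaussianFactor hb hε 0).integrable
    (differentiableOn_exp_mul_gaussianFactor hf ε 0).continuousOn hx
  have h2 := h.comp_smul Real.two_pi_pos.ne'
  have e : ∀ z : CSpace n, Complex.exp (-pairing 0 z) = 1 := fun z => by simp [pairing]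
  simp only [e, one_mul] at h2
  exact h2

lemma norm_gaussianFactor_smul_le {ε : ℝ} (hε : 0 ≤ ε) (x w : RSpace n) :
    ‖gaussianFactor ε (toComplex x ((2 * Real.pi) • w))‖ ≤ Real.exp (ε * ‖x‖ ^ 2) := by
  rw [norm_gaussianFactor]
  gcongr
  nlinarith [sq_nonneg ‖(2 * Real.pi) • w‖]

lemma memLp_scaledSlice_mul_gaussianFactor (hf : ContinuousOn f (tube D)) {ε : ℝ} (hε : 0 ≤ ε)
    {x : RSpace n} (hx : x ∈ D) (h2 : MemLp (scaledSlice f x) 2) :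
    MemLp (scaledSlice (fun z => f z * gaussianFactor ε z) x) 2 := by
  refine (h2.const_mul (Real.exp (ε * ‖x‖ ^ 2) : ℂ)).mono
    (continuous_scaledSlice (hf.mul
      (differentiable_gaussianFactor ε).continuous.continuousOn) hx).aestronglyMeasurable
    (Eventually.of_forall fun w => ?_)
  simp only [scaledSlice, norm_mul, Complex.norm_real, Real.norm_eq_abs, Real.abs_exp]
  rw [mul_comm]
  gcongr
  exact norm_gaussianFactor_smul_le hε x w

lemma tendsto_eLpNorm_scaledSlice_mul_gaussianFactor (hf : ContinuousOn f (tube D))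
    {x : RSpace n} (hx : x ∈ D) (h2 : MemLp (scaledSlice f x) 2) {ε : ℕ → ℝ}
    (hε : ∀ k, 0 < ε k) (hε1 : ∀ k, ε k ≤ 1) (hlim : Tendsto ε atTop (𝓝 0)) :
    Tendsto (fun k => eLpNorm (scaledSlice (fun z => f z * gaussianFactor (ε k) z) x -
      scaledSlice f x) 2 volume) atTop (𝓝 0) := by
  have hsq : Tendsto (fun k => ∫⁻ w, ‖(scaledSlice (fun z => f z * gaussianFactor (ε k) z) x -
      scaledSlice f x) w‖ₑ ^ 2) atTop (𝓝 (∫⁻ _ : RSpace n, 0)) := by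
    refine tendsto_lintegral_of_dominated_convergence'
      -- Since `ε ≤ 1`, the Gaussian factor minus `1` has modulus at most `e^{‖x‖²} + 1` on the
      -- slice over `x`.
      (fun w => ‖((Real.exp (‖x‖ ^ 2) + 1 : ℝ) : ℂ) * scaledSlice f x w‖ₑ ^ 2) (fun k => ?_)
      (fun k => Eventually.of_forall fun w => ?_) ?_ (Eventually.of_forall fun w => ?_)
    · exact (((continuous_scaledSlice (hf.mul
        (differentiable_gaussianFactor (ε k)).continuous.continuousOn) hx).sub
        (continuous_scaledSlice hf hx)).enorm.measurable.pow_const 2).aemeasurable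
    · have hle : ‖(scaledSlice (fun z => f z * gaussianFactor (ε k) z) x - scaledSlice f x) w‖ ≤
          ‖((Real.exp (‖x‖ ^ 2) + 1 : ℝ) : ℂ) * scaledSlice f x w‖ := by
        have e : (scaledSlice (fun z => f z * gaussianFactor (ε k) z) x - scaledSlice f x) w =
            (gaussianFactor (ε k) (toComplex x ((2 * Real.pi) • w)) - 1) * scaledSlice f x w := by
          simp only [Pi.sub_apply, scaledSlice]; ring
        rw [e, norm_mul, norm_mul, Complex.norm_real, Real.norm_of_nonneg (by positivity)]
        gcongr
        refine (norm_sub_le _ _).trans ?_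
        rw [norm_one]
        gcongr
        refine (norm_gaussianFactor_smul_le (hε k).le x w).trans ?_
        gcongr
        exact mul_le_of_le_one_left (sq_nonneg _) (hε1 k)
      exact pow_le_pow_left' (enorm_le_iff_norm_le.2 hle) 2
    · exact ((memLp_two_iff_lintegral (h2.const_mul _).1).1 (h2.const_mul _)).ne
    · have hg : Tendsto (fun k => gaussianFactor (ε k) (toComplex x ((2 * Real.pi) • w)))
          atTop (𝓝 1) := by
        have hc : Continuous fun a : ℝ => gaussianFactor a (toComplex x ((2 * Real.pi) • w)) := by
          unfold gaussianFactor
          fun_prop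
        have := (hc.tendsto 0).comp hlim
        simpa only [gaussianFactor, Function.comp_def, Complex.ofReal_zero, zero_mul,
          Complex.exp_zero] using this
      have h0 : Tendsto (fun k => (scaledSlice (fun z => f z * gaussianFactor (ε k) z) x -
          scaledSlice f x) w) atTop (𝓝 0) := by
        have := (hg.const_mul (scaledSlice f x w)).sub_const (scaledSlice f x w)
        simpa [scaledSlice] using this
      have := (ENNReal.continuous_pow 2).tendsto _ |>.comp
        ((continuous_enorm.tendsto (0 : ℂ)).comp h0)
      simpa only [Function.comp_def, enorm_zero, ne_eq, OfNat.ofNat_ne_zero, not_false_eq_true,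
        zero_pow] using this
  simp only [lintegral_enorm_sq_eq_eLpNorm, lintegral_zero] at hsq
  have := (ENNReal.continuous_rpow_const (y := 1 / 2)).tendsto _ |>.comp hsq
  simp only [Function.comp_def, ← ENNReal.rpow_natCast, ← ENNReal.rpow_mul] at this
  simpa using this

/-- The equality holds for every `t` after regularization. As `ε → 0` the regularized slices
converge in `L²`, hence so do their transforms, and a subsequence converges almost everywhere. -/
lemma ae_exp_neg_mul_fourier_toLp_scaledSlice_eq (hD : IsOpen D) (hconv : Convex ℝ D)
    (hf : DifferentiableOn ℂ f (tube D))
    (hb : ∀ x₀ ∈ D, ∃ r > 0, Metric.ball x₀ r ⊆ D ∧ ∃ M, ∀ x ∈ Metric.ball x₀ r, ∀ y,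
      ‖f (toComplex x y)‖ ≤ M) {x x' : RSpace n} (hx : x ∈ D) (hx' : x' ∈ D)
    (h2 : MemLp (scaledSlice f x) 2) (h2' : MemLp (scaledSlice f x') 2) :
    ∀ᵐ t, (Real.exp (-inner ℝ t x) : ℂ) *
        (𝓕 (h2.toLp (scaledSlice f x)) : Lp ℂ 2 (volume : Measure (RSpace n))) t =
      (Real.exp (-inner ℝ t x') : ℂ) *
        (𝓕 (h2'.toLp (scaledSlice f x')) : Lp ℂ 2 (volume : Measure (RSpace n))) t := by
  set ε : ℕ → ℝ := fun k => 1 / ((k : ℝ) + 1) with hε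
  have hε0 : ∀ k, 0 < ε k := fun k => by positivity
  have hε1 : ∀ k, ε k ≤ 1 := fun k => by
    rw [hε, div_le_one (by positivity)]
    linarith [(Nat.cast_nonneg k : (0 : ℝ) ≤ k)]
  have hlim : Tendsto ε atTop (𝓝 0) := tendsto_one_div_add_atTop_nhds_zero_nat
  have key : ∀ {y : RSpace n} (_ : y ∈ D) (h : MemLp (scaledSlice f y) 2),
      TendstoInMeasure volume (fun k => 𝓕 (scaledSlice (fun z => f z * gaussianFactor (ε k) z) y))
        atTop (𝓕 (h.toLp (scaledSlice f y)) : Lp ℂ 2 (volume : Measure (RSpace n))) := by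
    intro y hy h
    have hm := fun k => memLp_scaledSlice_mul_gaussianFactor hf.continuousOn (hε0 k).le hy h
    have hL := (Lp.tendsto_Lp_iff_tendsto_eLpNorm'' _ hm _ h).2
      (tendsto_eLpNorm_scaledSlice_mul_gaussianFactor hf.continuousOn hy h hε0 hε1 hlim)
    have hL2 := ((Lp.fourierTransformₗᵢ (RSpace n) ℂ).continuous.tendsto _).comp hL
    refine (tendstoInMeasure_of_tendsto_Lp hL2).congr_left fun k => ?_
    exact coeFn_fourier_toLp (integrable_scaledSlice_mul_gaussianFactor hf hb (hε0 k) hy) (hm k)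
  obtain ⟨ns, hns, h1⟩ := (key hx h2).exists_seq_tendsto_ae
  -- Extracted from the first subsequence, so that both slices converge along a common one.
  obtain ⟨ms, hms, h1'⟩ := ((key hx' h2').comp hns.tendsto_atTop).exists_seq_tendsto_ae
  filter_upwards [h1, h1'] with t ht ht'
  have e1 := (ht.comp hms.tendsto_atTop).const_mul (Real.exp (-inner ℝ t x) : ℂ)
  have e2 := ht'.const_mul (Real.exp (-inner ℝ t x') : ℂ)
  refine tendsto_nhds_unique e1 (e2.congr fun k => ?_)
  exact exp_neg_mul_fourier_scaledSlice_eq hD hconv hf hb (hε0 _) hx' hx t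

end GaussianRegularization

/-! ### From a Bergman function to its density -/

section Converse

open FourierTransform

variable {n : ℕ} {D : Set (RSpace n)} {W : RSpace n → ENNReal} {f : CSpace n → ℂ}

lemma exists_mem_of_ae_restrict {U : Set (RSpace n)} (hU : IsOpen U) (hne : U.Nonempty)
    (hUD : U ⊆ D) {P : RSpace n → Prop} (h : ∀ᵐ x ∂volume.restrict D, P x) : ∃ x ∈ U, P x := by
  have h1 : ∀ᵐ x ∂volume.restrict U, x ∈ U ∧ P x :=
    (ae_restrict_mem hU.measurableSet).and (ae_restrict_of_ae_restrict_of_subset hUD h)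
  have : NeBot (ae (volume.restrict U)) := by
    rw [ae_neBot, Ne, Measure.restrict_eq_zero]
    exact (hU.measure_pos volume hne).ne'
  exact h1.exists

/-- By Tonelli the slice norm times `W x` is finite for almost every `x ∈ D`, and `W x ≠ 0` there.
-/
lemma IsTubeWeight.ae_lintegral_slice_lt_top (hW : IsTubeWeight D W)
    (hf : ContinuousOn f (tube D)) (hfin : ∫⁻ p : RSpace n × RSpace n in D ×ˢ univ,
      ‖f (toComplex p.1 p.2)‖ₑ ^ 2 * W p.1 < ⊤) :
    ∀ᵐ x ∂volume.restrict D, ∫⁻ y, ‖f (toComplex x y)‖ₑ ^ 2 < ⊤ := by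
  have hD := hW.isOpen.measurableSet
  have hq : Measurable ((tube D).indicator fun z => ‖f z‖ₑ ^ 2) := by
    refine ContinuousOn.measurable_indicator ?_ (isOpen_tube hW.isOpen).measurableSet
    exact (ENNReal.continuous_pow 2).comp_continuousOn (continuous_enorm.comp_continuousOn hf)
  have hN : Measurable fun x => ∫⁻ y, (tube D).indicator (fun z => ‖f z‖ₑ ^ 2) (toComplex x y) :=
    (hq.comp continuous_toComplex.measurable).lintegral_prod_right'
  have heq : ∀ x ∈ D, ∫⁻ y, (tube D).indicator (fun z => ‖f z‖ₑ ^ 2) (toComplex x y) =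
      ∫⁻ y, ‖f (toComplex x y)‖ₑ ^ 2 := fun x hx =>
    lintegral_congr fun y => indicator_of_mem (toComplex_mem_tube.2 hx) _
  have hint : ∫⁻ x in D, (∫⁻ y, (tube D).indicator (fun z => ‖f z‖ₑ ^ 2) (toComplex x y)) * W x
      ≠ ⊤ := by
    rw [hW.lintegral_tube hf] at hfin
    rw [setLIntegral_congr_fun hD fun x hx => by rw [heq x hx]]
    exact hfin.ne
  filter_upwards [ae_lt_top' (hN.aemeasurable.mul hW.aemeasurable.restrict) hint,
    ae_restrict_mem hD] with x hx hxD
  obtain ⟨r, hr, c, hc, -, hle⟩ := hW.exists_le x hxD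
  have hW0 : W x ≠ 0 := fun h0 => by
    have := hle x (Metric.mem_ball_self hr)
    rw [h0, nonpos_iff_eq_zero, ENNReal.ofReal_eq_zero] at this
    exact absurd hc this.not_gt
  rw [Pi.mul_apply, heq x hxD, ENNReal.mul_lt_top_iff] at hx
  rcases hx with h | h | h
  · exact h.1
  · rw [h]; exact ENNReal.zero_lt_top
  · exact absurd h hW0

lemma lintegral_slice_eq_scaledSlice (hf : ContinuousOn f (tube D)) {x : RSpace n} (hx : x ∈ D) :
    ∫⁻ y, ‖f (toComplex x y)‖ₑ ^ 2 =
      ENNReal.ofReal ((2 * Real.pi) ^ n) * ∫⁻ w, ‖scaledSlice f x w‖ₑ ^ 2 := by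
  rw [lintegral_eq_ofReal_pow_mul_lintegral_comp_smul Real.two_pi_pos
    ((continuous_slice hf hx).enorm.measurable.pow_const 2).aemeasurable]
  simp only [finrank_euclideanSpace, Fintype.card_fin, scaledSlice]

lemma memLp_scaledSlice (hf : ContinuousOn f (tube D)) {x : RSpace n} (hx : x ∈ D)
    (h : ∫⁻ y, ‖f (toComplex x y)‖ₑ ^ 2 < ⊤) : MemLp (scaledSlice f x) 2 := by
  rw [memLp_two_iff_lintegral (continuous_scaledSlice hf hx).aestronglyMeasurable]
  rw [lintegral_slice_eq_scaledSlice hf hx, ENNReal.mul_lt_top_iff] at h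
  rcases h with h | h | h
  · exact h.2
  · exact absurd h (by simpa using (by positivity : 0 < (2 * Real.pi) ^ n))
  · rw [h]; exact ENNReal.zero_lt_top

/-- Fourier inversion for an `L²` function whose transform is integrable. -/
lemma ae_eq_fourierInv_of_fourier_toLp_ae_eq {u h : RSpace n → ℂ} (hu : MemLp u 2)
    (hh : Integrable h) (hh2 : MemLp h 2)
    (heq : (𝓕 (hu.toLp u) : Lp ℂ 2 (volume : Measure (RSpace n))) =ᵐ[volume] h) :
    u =ᵐ[volume] 𝓕⁻ h := by
  have e : hh2.toLp h = (𝓕 (hu.toLp u) : Lp ℂ 2 (volume : Measure (RSpace n))) :=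
    Lp.ext (hh2.coeFn_toLp.trans heq.symm)
  have h1 := coeFn_fourierInv_toLp hh hh2
  rw [e, FourierTransform.fourierInv_fourier_eq] at h1
  exact hu.coeFn_toLp.symm.trans h1

/-- Every function in the weighted Bergman space of a tube over a convex base is the
Fourier–Laplace transform of a density that is square integrable against the Laplace transform of
the weight. -/
theorem IsTubeWeight.exists_eq_fourierLaplace (hW : IsTubeWeight D W) (hconv : Convex ℝ D)
    (hf : DifferentiableOn ℂ f (tube D)) (hfin : ∫⁻ p : RSpace n × RSpace n in D ×ˢ univ,
      ‖f (toComplex p.1 p.2)‖ₑ ^ 2 * W p.1 < ⊤) :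
    ∃ g : RSpace n → ℂ, AEStronglyMeasurable g volume ∧
      ∫⁻ t, ‖g t‖ₑ ^ 2 * laplaceWeight W t < ⊤ ∧ ∀ z ∈ tube D, f z = fourierLaplace g z := by
  rcases D.eq_empty_or_nonempty with hE | hne
  · refine ⟨0, aestronglyMeasurable_zero, by simp, fun z hz => ?_⟩
    simp [tube, hE] at hz
  have hD := hW.isOpen
  have hfc := hf.continuousOn
  have hb := fun x₀ hx₀ => hW.exists_norm_le hf hfin (x₀ := x₀) hx₀
  have hgood := hW.ae_lintegral_slice_lt_top hfc hfin
  obtain ⟨x₀, hx₀, hfin₀⟩ := exists_mem_of_ae_restrict hD hne subset_rfl hgood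
  have hm₀ := memLp_scaledSlice hfc hx₀ hfin₀
  -- The only possible density: the transform of the slice over `x₀` must be `e^{t·x₀} g(t)`.
  set g : RSpace n → ℂ := fun t => (Real.exp (-inner ℝ t x₀) : ℂ) *
    (𝓕 (hm₀.toLp (scaledSlice f x₀)) : Lp ℂ 2 (volume : Measure (RSpace n))) t with hg
  have hgm : AEStronglyMeasurable g volume :=
    aestronglyMeasurable_exp_mul (Lp.aestronglyMeasurable _) (by fun_prop)
  have hslice : ∀ {x : RSpace n} (_ : x ∈ D) (hm : MemLp (scaledSlice f x) 2),
      (𝓕 (hm.toLp (scaledSlice f x)) : Lp ℂ 2 (volume : Measure (RSpace n))) =ᵐ[volume]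
        fun t => (Real.exp (inner ℝ t x) : ℂ) * g t := by
    intro x hx hm
    filter_upwards [ae_exp_neg_mul_fourier_toLp_scaledSlice_eq hD hconv hf hb hx hx₀ hm hm₀]
      with t ht
    rw [hg]
    simp only
    rw [← ht, ← mul_assoc, ← Complex.ofReal_mul, ← Real.exp_add]
    simp
  have hnorm : ∀ {x : RSpace n}, x ∈ D → ∫⁻ y, ‖f (toComplex x y)‖ₑ ^ 2 < ⊤ →
      ENNReal.ofReal ((2 * Real.pi) ^ n) *
        ∫⁻ t, ENNReal.ofReal (Real.exp (2 * inner ℝ t x)) * ‖g t‖ₑ ^ 2 =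
      ∫⁻ y, ‖f (toComplex x y)‖ₑ ^ 2 := by
    intro x hx hxfin
    have hm := memLp_scaledSlice hfc hx hxfin
    rw [lintegral_slice_eq_scaledSlice hfc hx, ← lintegral_enorm_sq_fourier_toLp hm]
    congr 1
    refine lintegral_congr_ae ?_
    filter_upwards [hslice hx hm] with t ht
    exact (enorm_ofReal_exp_mul_sq _ _).symm.trans (by rw [ht])
  have hgfin : ∫⁻ t, ‖g t‖ₑ ^ 2 * laplaceWeight W t < ⊤ := by
    have h1 : ENNReal.ofReal ((2 * Real.pi) ^ n) * ∫⁻ t, ‖g t‖ₑ ^ 2 * laplaceWeight W t < ⊤ := by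
      rw [hW.lintegral_mul_laplaceWeight hgm, ← lintegral_const_mul' _ _ ENNReal.ofReal_ne_top]
      refine lt_of_le_of_lt (le_of_eq ?_) hfin
      rw [hW.lintegral_tube hfc]
      refine lintegral_congr_ae ?_
      filter_upwards [hgood, ae_restrict_mem hD.measurableSet] with x hx hxD
      rw [← mul_assoc, hnorm hxD hx]
    rcases ENNReal.mul_lt_top_iff.1 h1 with h | h | h
    · exact h.2
    · exact absurd h (by simpa using (by positivity : 0 < (2 * Real.pi) ^ n))
    · rw [h]; exact ENNReal.zero_lt_top
  have hLc := (hW.differentiableOn_fourierLaplace hgm hgfin).continuousOn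
  -- `L²` inversion gives equality for almost every `y`; both sides are continuous in `y`, so it
  -- holds for all.
  have hgoodeq : ∀ x ∈ D, ∫⁻ y, ‖f (toComplex x y)‖ₑ ^ 2 < ⊤ →
      ∀ y, f (toComplex x y) = fourierLaplace g (toComplex x y) := by
    intro x hx hxfin y
    have hm := memLp_scaledSlice hfc hx hxfin
    have hint : Integrable fun t => (Real.exp (inner ℝ t x) : ℂ) * g t := by
      have h := hW.integrable_exp_pairing_mul hgm hgfin (z := toComplex x 0)
        (toComplex_mem_tube.2 hx)
      simpa [pairing_toComplex] using h
    have h1 := ae_eq_fourierInv_of_fourier_toLp_ae_eq hm hint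
      (hW.memLp_exp_inner_mul hgm hgfin hx) (hslice hx hm)
    have h2 := congrFun (((continuous_scaledSlice hfc hx).ae_eq_iff_eq volume
      (Real.continuous_fourierInv hint)).1 h1) ((2 * Real.pi)⁻¹ • y)
    rwa [← fourierLaplace_toComplex_smul, scaledSlice,
      smul_inv_smul₀ Real.two_pi_pos.ne'] at h2
  refine ⟨g, hgm, hgfin, fun z hz => ?_⟩
  by_contra hzne
  obtain ⟨y, hy⟩ : ∃ y, imPart z = y := ⟨_, rfl⟩
  have hc : ∀ {h : CSpace n → ℂ}, ContinuousOn h (tube D) →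
      ContinuousOn (fun x => h (toComplex x y)) D := fun hh =>
    hh.comp (continuous_id.toComplex continuous_const).continuousOn
      fun x hx => toComplex_mem_tube.2 hx
  -- For fixed `y`, the base points where the two functions differ form an open set. If nonempty it
  -- would have positive measure and so contain a square integrable slice, on which they agree.
  have hU : IsOpen (D ∩ {x | f (toComplex x y) - fourierLaplace g (toComplex x y) ≠ 0}) :=
    ((hc hfc).sub (hc hLc)).isOpen_inter_preimage hD isOpen_ne
  obtain ⟨x, hx, hxfin⟩ := exists_mem_of_ae_restrict hU
    ⟨rePart z, hz, sub_ne_zero.2 (by rwa [← hy, toComplex_rePart_imPart])⟩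
    inter_subset_left hgood
  exact hx.2 (sub_eq_zero.2 (hgoodeq x hx.1 hxfin y))

end Converse

end

/-- `PW(e^{φ̃})` and `A²(e^{-φ})` coincide as spaces of functions on the tube over the interior of
`{φ < ∞}`; the norms are related by the factor `(2π)ⁿ`, whichever density `g` represents `f`; and
every density of finite weighted norm does define an element of the space. -/
theorem proposition3p1 (n : ℕ) (φ : RSpace n → EReal) (hφ : IsConvexFunction φ) :
    paleyWienerSpace (finiteDomain φ) (logLaplace φ) = bergmanSpace φ ∧
    (∀ (f : CSpace n → ℂ) (g : RSpace n → ℂ),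
      IsPWRepresentation (finiteDomain φ) (logLaplace φ) g f →
        bergmanNormSq φ f = ENNReal.ofReal ((2 * Real.pi) ^ n) * pwNormSq (logLaplace φ) g) ∧
    (∀ g : RSpace n → ℂ, AEStronglyMeasurable g volume → pwNormSq (logLaplace φ) g < ⊤ →
      IsPWRepresentation (finiteDomain φ) (logLaplace φ) g (fourierLaplace g)) := by
  have hW := hφ.isTubeWeight
  have hpw : ∀ g, pwNormSq (logLaplace φ) g =
      ∫⁻ t, ‖g t‖ₑ ^ 2 * laplaceWeight (fun x => EReal.exp (-φ x)) t := fun g => by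
    simp only [pwNormSq, exp_logLaplace]
  have hrep : ∀ g : RSpace n → ℂ, AEStronglyMeasurable g volume →
      pwNormSq (logLaplace φ) g < ⊤ →
      IsPWRepresentation (finiteDomain φ) (logLaplace φ) g (fourierLaplace g) := by
    intro g hg hfin
    have hfin' := hfin
    rw [hpw] at hfin'
    exact ⟨hg, hfin, fun z hz => hW.integrable_exp_pairing_mul hg hfin' hz, fun _ _ => rfl,
      hW.differentiableOn_fourierLaplace hg hfin'⟩
  have hnorm : ∀ (f : CSpace n → ℂ) (g : RSpace n → ℂ),
      IsPWRepresentation (finiteDomain φ) (logLaplace φ) g f →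
        bergmanNormSq φ f =
          ENNReal.ofReal ((2 * Real.pi) ^ n) * pwNormSq (logLaplace φ) g := by
    intro f g h
    have hfin := h.normSq_lt_top
    rw [hpw] at hfin ⊢
    rw [← hW.lintegral_tube_fourierLaplace h.aestronglyMeasurable hfin]
    refine setLIntegral_congr_fun (hW.isOpen.measurableSet.prod MeasurableSet.univ)
      fun p hp => ?_
    simp only [h.eq_fourierLaplace _ (toComplex_mem_tube.2 hp.1)]
  refine ⟨Set.Subset.antisymm ?_ ?_, hnorm, hrep⟩
  · rintro f ⟨g, h⟩
    refine ⟨h.holomorphic, ?_⟩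
    rw [hnorm f g h]
    exact ENNReal.mul_lt_top ENNReal.ofReal_lt_top h.normSq_lt_top
  · rintro f ⟨hf, hfin⟩
    obtain ⟨g, hg, hgfin, heq⟩ := hW.exists_eq_fourierLaplace hφ.convex_finiteDomain hf hfin
    rw [← hpw] at hgfin
    have h := hrep g hg hgfin
    exact ⟨g, hg, hgfin, h.integrable, heq, hf⟩
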